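/- Let $X$ be a paracompact Hausdorff smooth ($C^\infty$) manifold of dimension $n$, and put $I=(0,1]$. *Generalized functions.* For $\Omega\subseteq\mathbb R^n$ open, a net $(u_\varepsilon)_{\varepsilon\in I}$ in $C^\infty(\Omega)$ is *moderate* if for every compact $K\subset\Omega$ and every $k\in\mathbb N_0$ there is $N\in\mathbb N$ with $\sup_{K}\|D^k u_\varepsilon\|=O(\varepsilon^{-N})$ as $\varepsilon\to0$, and *negligible* if for all such $K$, $k$ and all $m\in\mathbb N$ one has $\sup_K\|D^ku_\varepsilon\|=O(\varepsilon^m)$. The ring $\mathcal G(\Omega)$ is the quotient of the moderate nets by the negligible ones; the ring $\widetilde{\mathbb R}$ of generalized real numbers is defined in the same way from nets of real numbers. $\mathcal G(X)$, the space $\mathcal G(X,TX)$ of generalized vector fields and the space $\mathcal G^0_2(X)$ of generalized $(0,2)$-tensor fields are the quotients of moderate nets by negligible nets of smooth functions, vector fields and $(0,2)$-tensor fields on $X$, respectively, where moderateness and negligibility are required of all components in all smooth charts. A generalized tensor field $g=[(g_\varepsilon)_\varepsilon]\in\mathcal G^0_2(X)$ induces the map $\mathcal G(X,TX)\times\mathcal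 G(X,TX)\to\mathcal G(X)$, $g(\xi,\eta)=[(g_\varepsilon(\xi_\varepsilon,\eta_\varepsilon))_\varepsilon]$. In a chart $(V,\psi)$ it has a component matrix $(g_{ij})$ with entries in $\mathcal G(\psi(V))$, and $\det g\in\mathcal G(\psi(V))$ denotes the determinant of this matrix. *Generalized points.* For $\Omega\subseteq\mathbb R^n$ open, $\widetilde\Omega_c$ is the set of nets $(x_\varepsilon)_\varepsilon$ in $\Omega$ that stay in some fixed compact subset of $\Omega$ for small $\varepsilon$, modulo the relation $|x_\varepsilon-y_\varepsilon|=O(\varepsilon^m)$ for all $m$. For $u\in\mathcal G(\Omega)$ and $\widetilde x\in\widetilde\Omega_c$ put $u(\widetilde x)=[(u_\varepsilon(x_\varepsilon))_\varepsilon]\in\widetilde{\mathbb R}$. For a chart $(V,\psi)$ and $\widetilde x\in(\psi(V))^\sim_c$ let $g_\psi(\widetilde x):\widetilde{\mathbb R}^n\times\widetilde{\mathbb R}^n\to\widetilde{\mathbb R}$ be the $\widetilde{\mathbb R}$-bilinear form with matrix $(g_{ij}(\widetilde x))$; a bilinear form $b$ is called non-degenerate if $b(v,\cdot)=0$ implies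 $v=0$ and $b(\cdot,v)=0$ implies $v=0$. **Theorem.** Let $g\in\mathcal G^0_2(X)$. The following are equivalent. 1. For each smooth chart $(V,\psi)$ of $X$ and each $\widetilde x\in(\psi(V))^\sim_c$, the map $g_\psi(\widetilde x):\widetilde{\mathbb R}^n\times\widetilde{\mathbb R}^n\to\widetilde{\mathbb R}$ is symmetric and non-degenerate. 2. The map $g:\mathcal G(X,TX)\times\mathcal G(X,TX)\to\mathcal G(X)$ is symmetric, and for each smooth chart $(V,\psi)$ of $X$, $\det g$ is invertible in $\mathcal G(\psi(V))$. 3. For each smooth chart $(V,\psi)$ of $X$, $\det g$ is invertible in $\mathcal G(\psi(V))$, and for each relatively compact open set $V\subseteq X$ there exist a representative $(g_\varepsilon)_\varepsilon$ of $g$ and $\varepsilon_0>0$ such that for all $\varepsilon<\varepsilon_0$ the restriction $g_\varepsilon|_V$ is a smooth pseudo-Riemannian metric, that is, a smooth symmetric $(0,2)$-tensor field that is non-degenerate on $T_pX$ for every $p\in V$ (its index is then locally constant on $V$). -/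

import Mathlib

open Set Filter Topology Bundle
open scoped ContDiff Manifold

-- `ℝⁿ` is to carry `chartedSpaceSelf` as its manifold structure, not a (definitionally equal)
-- wrapper of it.
attribute [-instance] TopCat.of.chartedSpace

noncomputable section

namespace Colombeau

/-! ### The regularisation parameter and growth scales -/

/-- The index set `(0,1]` of the special Colombeau algebra. -/
abbrev Eps : Type := Set.Ioc (0 : ℝ) 1

/-- The filter `ε → 0` on `(0,1]`. -/
def epsZero : Filter Eps := Filter.comap (fun ε : Eps => (ε : ℝ)) (𝓝 0)

theorem Eps.pos (ε : Eps) : (0 : ℝ) < ε := ε.2.1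

theorem Eps.ne_zero (ε : Eps) : (ε : ℝ) ≠ 0 := ε.pos.ne'

theorem Eps.zpow_isBigO {r s : ℤ} (h : r ≤ s) (l : Filter Eps) :
    (fun ε : Eps => (ε : ℝ) ^ s) =O[l] (fun ε : Eps => (ε : ℝ) ^ r) := by
  refine Asymptotics.IsBigO.of_bound 1 (Eventually.of_forall fun ε => ?_)
  rw [one_mul, Real.norm_of_nonneg (zpow_nonneg ε.pos.le _),
    Real.norm_of_nonneg (zpow_nonneg ε.pos.le _)]
  exact zpow_le_zpow_right_of_le_one₀ ε.pos ε.2.2 h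

/-- Local coordinate space `ℝⁿ`. -/
abbrev RSpace (n : ℕ) : Type := EuclideanSpace ℝ (Fin n)

/-! ### Generalized real numbers -/

/-- Moderate nets of real numbers: `|a_ε| = O(ε^{-N})` for some `N`. -/
def moderateReal : Subring (Eps → ℝ) where
  carrier := {a | ∃ N : ℕ, a =O[epsZero] (fun ε : Eps => (ε : ℝ) ^ (-(N : ℤ)))}
  zero_mem' := ⟨0, Asymptotics.isBigO_zero _ _⟩
  one_mem' := ⟨0, by simpa using Asymptotics.isBigO_refl (fun _ : Eps => (1 : ℝ)) epsZero⟩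
  add_mem' := by
    rintro a b ⟨N, hN⟩ ⟨M, hM⟩
    refine ⟨max N M, (hN.trans (Eps.zpow_isBigO ?_ _)).add (hM.trans (Eps.zpow_isBigO ?_ _))⟩ <;>
      simp
  neg_mem' := by
    rintro a ⟨N, hN⟩
    exact ⟨N, hN.neg_left⟩
  mul_mem' := by
    rintro a b ⟨N, hN⟩ ⟨M, hM⟩
    refine ⟨N + M, (hN.mul hM).congr_right fun ε => ?_⟩
    rw [← zpow_add₀ ε.ne_zero]
    congr 1
    push_cast
    ring

/-- Negligible nets of real numbers: `|a_ε| = O(ε^m)` for all `m`. -/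
def negligibleReal : Ideal moderateReal where
  carrier := {a | ∀ m : ℕ, (a : Eps → ℝ) =O[epsZero] (fun ε : Eps => (ε : ℝ) ^ (m : ℤ))}
  zero_mem' := fun _ => Asymptotics.isBigO_zero _ _
  add_mem' := fun ha hb m => (ha m).add (hb m)
  smul_mem' := by
    rintro ⟨c, N, hN⟩ a ha m
    refine (hN.mul (ha (m + N))).congr_right fun ε => ?_
    rw [← zpow_add₀ ε.ne_zero]
    congr 1
    push_cast
    ring

/-- The ring `ℝ̃` of generalized real numbers. -/
abbrev GReal : Type := moderateReal ⧸ negligibleReal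

/-! ### The special Colombeau algebra on an open subset of `ℝⁿ` -/

section Flat

variable {n : ℕ}

/-- `HasOrder Ω u K k r`: one has `sup_{x ∈ K} ‖Dᵏ u_ε(x)‖ = O(ε^r)` as `ε → 0`. -/
def HasOrder (Ω : TopologicalSpace.Opens (RSpace n)) (u : Eps → RSpace n → ℝ)
    (K : Set (RSpace n)) (k : ℕ) (r : ℤ) : Prop :=
  (fun p : Eps × RSpace n => iteratedFDerivWithin ℝ k (u p.1) Ω p.2)
    =O[epsZero ×ˢ 𝓟 K] (fun p : Eps × RSpace n => (p.1 : ℝ) ^ r)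

/-- All derivatives grow at most like some `ε^{-N}`, uniformly on compact subsets of `Ω`. -/
def IsModerate (Ω : TopologicalSpace.Opens (RSpace n)) (u : Eps → RSpace n → ℝ) : Prop :=
  ∀ K : Set (RSpace n), IsCompact K → K ⊆ Ω → ∀ k : ℕ, ∃ N : ℕ, HasOrder Ω u K k (-(N : ℤ))

/-- All derivatives vanish faster than every `ε^m`, uniformly on compact subsets of `Ω`. -/
def IsNegligible (Ω : TopologicalSpace.Opens (RSpace n)) (u : Eps → RSpace n → ℝ) : Prop :=
  ∀ K : Set (RSpace n), IsCompact K → K ⊆ Ω → ∀ k : ℕ, ∀ m : ℕ, HasOrder Ω u K k (m : ℤ)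

variable {Ω : TopologicalSpace.Opens (RSpace n)} {u v : Eps → RSpace n → ℝ}
  {K : Set (RSpace n)} {k : ℕ} {r s : ℤ}

theorem eventually_mem (l : Filter Eps) (K : Set (RSpace n)) :
    ∀ᶠ p : Eps × RSpace n in l ×ˢ 𝓟 K, p.2 ∈ K :=
  tendsto_snd.eventually (eventually_principal.2 fun _ h => h)

theorem HasOrder.mono (h : HasOrder Ω u K k r) (hs : s ≤ r) : HasOrder Ω u K k s :=
  Asymptotics.IsBigO.trans (g := fun p : Eps × RSpace n => (p.1 : ℝ) ^ r) h
    ((Eps.zpow_isBigO hs epsZero).comp_tendsto tendsto_fst)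

theorem HasOrder.congr (hK : K ⊆ Ω) (h : HasOrder Ω u K k r)
    (huv : ∀ ε, EqOn (u ε) (v ε) Ω) : HasOrder Ω v K k r := by
  refine h.congr' ?_ EventuallyEq.rfl
  filter_upwards [eventually_mem epsZero K] with p hp
  exact iteratedFDerivWithin_congr (huv p.1) (hK hp) k

theorem HasOrder.add (hu : ∀ ε, ContDiffOn ℝ ∞ (u ε) Ω) (hv : ∀ ε, ContDiffOn ℝ ∞ (v ε) Ω)
    (hK : K ⊆ Ω) (h : HasOrder Ω u K k r) (h' : HasOrder Ω v K k r) :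
    HasOrder Ω (u + v) K k r := by
  refine (Asymptotics.IsBigO.add h h').congr' ?_ EventuallyEq.rfl
  filter_upwards [eventually_mem epsZero K] with p hp
  have hx : p.2 ∈ (Ω : Set (RSpace n)) := hK hp
  exact (iteratedFDerivWithin_add_apply
    ((hu p.1 _ hx).of_le (by exact_mod_cast le_top))
    ((hv p.1 _ hx).of_le (by exact_mod_cast le_top)) Ω.isOpen.uniqueDiffOn hx).symm

theorem HasOrder.neg (hK : K ⊆ Ω) (h : HasOrder Ω u K k r) : HasOrder Ω (-u) K k r := by
  refine (Asymptotics.IsBigO.neg_left h).congr' ?_ EventuallyEq.rfl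
  filter_upwards [eventually_mem epsZero K] with p hp
  exact (iteratedFDerivWithin_neg_apply Ω.isOpen.uniqueDiffOn (hK hp)).symm

theorem HasOrder.mul (hu : ∀ ε, ContDiffOn ℝ ∞ (u ε) Ω) (hv : ∀ ε, ContDiffOn ℝ ∞ (v ε) Ω)
    (hK : K ⊆ Ω) (h : ∀ i ≤ k, HasOrder Ω u K i r) (h' : ∀ i ≤ k, HasOrder Ω v K i s) :
    HasOrder Ω (u * v) K k (r + s) := by
  have key : (fun p : Eps × RSpace n => ∑ i ∈ Finset.range (k + 1),
      (k.choose i : ℝ) * ‖iteratedFDerivWithin ℝ i (u p.1) Ω p.2‖ *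
        ‖iteratedFDerivWithin ℝ (k - i) (v p.1) Ω p.2‖)
      =O[epsZero ×ˢ 𝓟 K] (fun p : Eps × RSpace n => (p.1 : ℝ) ^ (r + s)) := by
    refine Asymptotics.IsBigO.fun_sum fun i hi => ?_
    have h1 := Asymptotics.IsBigO.norm_left (h i (Nat.lt_succ_iff.1 (Finset.mem_range.1 hi)))
    have h2 := Asymptotics.IsBigO.norm_left (h' (k - i) (Nat.sub_le _ _))
    refine ((h1.const_mul_left (k.choose i : ℝ)).mul h2).congr_right fun p => ?_
    rw [← zpow_add₀ p.1.ne_zero]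
  refine Asymptotics.IsBigO.trans (Asymptotics.IsBigO.of_bound 1 ?_) key
  filter_upwards [eventually_mem epsZero K] with p hp
  rw [one_mul]
  exact (norm_iteratedFDerivWithin_mul_le (N := ∞) (hu p.1) (hv p.1) Ω.isOpen.uniqueDiffOn
    (hK hp) (by exact_mod_cast le_top)).trans (Real.le_norm_self _)

theorem IsModerate.exists_uniform (h : IsModerate Ω u) (hc : IsCompact K) (hK : K ⊆ Ω) (k : ℕ) :
    ∃ N : ℕ, ∀ i ≤ k, HasOrder Ω u K i (-(N : ℤ)) := by
  choose N hN using h K hc hK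
  refine ⟨(Finset.range (k + 1)).sup N, fun i hi => (hN i).mono ?_⟩
  have : N i ≤ (Finset.range (k + 1)).sup N :=
    Finset.le_sup (Finset.mem_range.2 (Nat.lt_succ_iff.2 hi))
  omega

theorem IsModerate.congr (h : IsModerate Ω u) (huv : ∀ ε, EqOn (u ε) (v ε) Ω) :
    IsModerate Ω v := fun K hc hK k =>
  let ⟨N, hN⟩ := h K hc hK k
  ⟨N, hN.congr hK huv⟩

theorem IsNegligible.congr (h : IsNegligible Ω u) (huv : ∀ ε, EqOn (u ε) (v ε) Ω) :
    IsNegligible Ω v := fun K hc hK k m => (h K hc hK k m).congr hK huv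

theorem isNegligible_zero : IsNegligible Ω 0 := by
  intro K _ hK k m
  refine (Asymptotics.isBigO_zero _ _).congr' (f₁ := fun _ => 0) ?_ EventuallyEq.rfl
  filter_upwards with p
  change 0 = iteratedFDerivWithin ℝ k (fun _ : RSpace n => (0 : ℝ)) Ω p.2
  rw [iteratedFDerivWithin_fun_zero]
  rfl

theorem isModerate_const (c : ℝ) : IsModerate Ω (fun _ _ => c) := by
  intro K _ hK k
  refine ⟨0, ?_⟩
  rcases Nat.eq_zero_or_pos k with rfl | hk
  · refine Asymptotics.IsBigO.of_bound ‖c‖ (Eventually.of_forall fun p => ?_)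
    simp
  · refine (Asymptotics.isBigO_zero _ _).congr' (f₁ := fun _ => 0) ?_ EventuallyEq.rfl
    filter_upwards with p
    rw [iteratedFDerivWithin_const_of_ne hk.ne']
    rfl

variable (Ω) in
/-- Moderate nets of smooth functions on `Ω`. A smooth function on `Ω` is represented by a function
on `ℝⁿ` that is smooth on `Ω`; its values outside `Ω` enter no condition. -/
def moderateFun : Subring (Eps → RSpace n → ℝ) where
  carrier := {u | (∀ ε, ContDiffOn ℝ ∞ (u ε) Ω) ∧ IsModerate Ω u}
  zero_mem' := ⟨fun _ => contDiffOn_const, isModerate_const 0⟩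
  one_mem' := ⟨fun _ => contDiffOn_const, isModerate_const 1⟩
  add_mem' := by
    rintro u v ⟨hu, hu'⟩ ⟨hv, hv'⟩
    refine ⟨fun ε => (hu ε).add (hv ε), fun K hc hK k => ?_⟩
    obtain ⟨N, hN⟩ := hu' K hc hK k
    obtain ⟨M, hM⟩ := hv' K hc hK k
    exact ⟨max N M, (hN.mono (by simp)).add hu hv hK (hM.mono (by simp))⟩
  neg_mem' := by
    rintro u ⟨hu, hu'⟩
    refine ⟨fun ε => (hu ε).neg, fun K hc hK k => ?_⟩
    obtain ⟨N, hN⟩ := hu' K hc hK k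
    exact ⟨N, hN.neg hK⟩
  mul_mem' := by
    rintro u v ⟨hu, hu'⟩ ⟨hv, hv'⟩
    refine ⟨fun ε => (hu ε).mul (hv ε), fun K hc hK k => ?_⟩
    obtain ⟨N, hN⟩ := hu'.exists_uniform hc hK k
    obtain ⟨M, hM⟩ := hv'.exists_uniform hc hK k
    refine ⟨N + M, (HasOrder.mul hu hv hK hN hM).mono ?_⟩
    push_cast
    omega

theorem IsNegligible.mul_left (hu : u ∈ moderateFun Ω) (hv : ∀ ε, ContDiffOn ℝ ∞ (v ε) Ω)
    (h : IsNegligible Ω v) : IsNegligible Ω (u * v) := by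
  intro K hc hK k m
  obtain ⟨N, hN⟩ := hu.2.exists_uniform hc hK k
  refine (HasOrder.mul hu.1 hv hK hN (fun i _ => h K hc hK i (m + N))).mono ?_
  push_cast
  omega

variable (Ω) in
/-- Negligible nets of smooth functions on `Ω`. -/
def negligibleFun : Ideal (moderateFun Ω) where
  carrier := {u | IsNegligible Ω u}
  zero_mem' := isNegligible_zero
  add_mem' := fun {a b} ha hb K hc hK k m =>
    (ha K hc hK k m).add a.2.1 b.2.1 hK (hb K hc hK k m)
  smul_mem' := fun c a ha => IsNegligible.mul_left c.2 a.2.1 ha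

variable (Ω) in
/-- The special Colombeau algebra `𝒢(Ω)` of an open set `Ω ⊆ ℝⁿ`. -/
abbrev GFun : Type := moderateFun Ω ⧸ negligibleFun Ω

/-! ### Compactly supported generalized points and point values -/

variable (Ω) in
/-- Nets of points of `Ω` that stay in a fixed compact subset of `Ω` for small `ε`. -/
def CompactNet : Type :=
  {x : Eps → RSpace n // (∀ ε, x ε ∈ Ω) ∧
    ∃ K : Set (RSpace n), IsCompact K ∧ K ⊆ Ω ∧ ∀ᶠ ε in epsZero, x ε ∈ K}

variable (Ω) in
/-- Two nets are equivalent if `|x_ε - y_ε| = O(ε^m)` for all `m`. -/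
instance compactNetSetoid : Setoid (CompactNet Ω) where
  r x y := ∀ m : ℕ, (fun ε => x.1 ε - y.1 ε) =O[epsZero] (fun ε : Eps => (ε : ℝ) ^ (m : ℤ))
  iseqv :=
    { refl := fun x m => by simpa using Asymptotics.isBigO_zero _ _
      symm := fun {x y} h m => (h m).neg_left.congr_left fun ε => by simp
      trans := fun {x y z} h h' m => ((h m).add (h' m)).congr_left fun ε => by simp }

variable (Ω) in
/-- The set `Ω̃_c` of compactly supported generalized points of `Ω`. -/
def GPoint : Type := Quotient (compactNetSetoid Ω)

theorem HasOrder.comp (x : Eps → RSpace n) (hx : ∀ᶠ ε in epsZero, x ε ∈ K)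
    (h : HasOrder Ω u K k r) :
    (fun ε => iteratedFDerivWithin ℝ k (u ε) Ω (x ε)) =O[epsZero] (fun ε : Eps => (ε : ℝ) ^ r) :=
  Asymptotics.IsBigO.comp_tendsto h (k := fun ε => (ε, x ε))
    (tendsto_id.prodMk (tendsto_principal.2 hx))

theorem HasOrder.comp_zero (x : Eps → RSpace n) (hx : ∀ᶠ ε in epsZero, x ε ∈ K)
    (h : HasOrder Ω u K 0 r) :
    (fun ε => u ε (x ε)) =O[epsZero] (fun ε : Eps => (ε : ℝ) ^ r) :=
  (h.comp x hx).norm_left.congr_left (fun _ => norm_iteratedFDerivWithin_zero) |>.of_norm_left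

theorem tendsto_eps : Tendsto (fun ε : Eps => (ε : ℝ)) epsZero (𝓝 0) := tendsto_comap

theorem pointValue_sub_isBigO (hu : u ∈ moderateFun Ω) (x y : CompactNet Ω)
    (hxy : compactNetSetoid Ω x y) (m : ℕ) :
    (fun ε => u ε (x.1 ε) - u ε (y.1 ε)) =O[epsZero] (fun ε : Eps => (ε : ℝ) ^ (m : ℤ)) := by
  obtain ⟨K, hc, hK, hxK⟩ := x.2.2
  obtain ⟨δ, hδ, hδΩ⟩ := hc.exists_cthickening_subset_open Ω.isOpen hK
  obtain ⟨N, hN⟩ := hu.2 _ (hc.cthickening (r := δ)) hδΩ 1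
  obtain ⟨C, hC⟩ := hN.bound
  rw [eventually_prod_principal_iff] at hC
  have h0 : Tendsto (fun ε => x.1 ε - y.1 ε) epsZero (𝓝 0) :=
    (hxy 1).trans_tendsto (by simpa using tendsto_eps)
  have hclose : ∀ᶠ ε in epsZero, ‖x.1 ε - y.1 ε‖ < δ := by
    have := h0.norm
    rw [norm_zero] at this
    exact this.eventually_lt_const hδ
  have hscale := hxy (m + N)
  have hmain : (fun ε => u ε (x.1 ε) - u ε (y.1 ε)) =O[epsZero]
      (fun ε : Eps => (ε : ℝ) ^ (-(N : ℤ)) * ‖x.1 ε - y.1 ε‖) := by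
    refine Asymptotics.IsBigO.of_bound C ?_
    filter_upwards [hC, hclose, hxK] with ε h1 h2 h3
    have hball : Metric.closedBall (x.1 ε) δ ⊆ Metric.cthickening δ K :=
      Metric.closedBall_subset_cthickening h3 δ
    have := (convex_closedBall (x.1 ε) δ).norm_image_sub_le_of_norm_hasFDerivWithin_le
      (f := u ε) (f' := fderivWithin ℝ (u ε) Ω) (C := C * ‖(ε : ℝ) ^ (-(N : ℤ))‖)
      (x := y.1 ε) (y := x.1 ε)
      (fun z hz => by
        have hzΩ := hδΩ (hball hz)
        have hd := ((hu.1 ε).differentiableOn (by simp)) z hzΩ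
        exact (hd.hasFDerivWithinAt.hasFDerivAt (Ω.isOpen.mem_nhds hzΩ)).hasFDerivWithinAt)
      (fun z hz => by
        have hzΩ := hδΩ (hball hz)
        have := h1 z (hball hz)
        rwa [norm_iteratedFDerivWithin_one _ (Ω.isOpen.uniqueDiffWithinAt hzΩ)] at this)
      (by rw [Metric.mem_closedBall, dist_comm, dist_eq_norm]; exact h2.le)
      (Metric.mem_closedBall_self hδ.le)
    rwa [norm_mul, norm_norm, ← mul_assoc]
  refine (hmain.trans ((Asymptotics.isBigO_refl _ _).mul hscale.norm_left)).congr_right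
    fun ε => ?_
  rw [← zpow_add₀ ε.ne_zero]
  congr 1
  push_cast
  ring

/-- The ring homomorphism `(u_ε)_ε ↦ (u_ε(x_ε))_ε` on moderate nets. -/
def netEval (x : CompactNet Ω) : moderateFun Ω →+* moderateReal where
  toFun u := ⟨fun ε => u.1 ε (x.1 ε), by
    obtain ⟨K, hc, hK, hxK⟩ := x.2.2
    obtain ⟨N, hN⟩ := u.2.2 K hc hK 0
    exact ⟨N, hN.comp_zero x.1 hxK⟩⟩
  map_zero' := rfl
  map_one' := rfl
  map_add' _ _ := rfl
  map_mul' _ _ := rfl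

theorem netEval_mem (x : CompactNet Ω) (u : moderateFun Ω) (hu : u ∈ negligibleFun Ω) :
    netEval x u ∈ negligibleReal := by
  obtain ⟨K, hc, hK, hxK⟩ := x.2.2
  exact fun m => (hu K hc hK 0 m).comp_zero x.1 hxK

/-- The point value `u(x̃) = [(u_ε(x_ε))_ε] ∈ ℝ̃` of `u ∈ 𝒢(Ω)` at `x̃ ∈ Ω̃_c`, as a ring
homomorphism in `u`. -/
def pointValue (x : GPoint Ω) : GFun Ω →+* GReal :=
  Quotient.lift
    (fun x : CompactNet Ω => Ideal.quotientMap negligibleReal (netEval x) (netEval_mem x))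
    (fun x y hxy => Ideal.Quotient.ringHom_ext (RingHom.ext fun u =>
      Ideal.Quotient.eq.2 fun m => pointValue_sub_isBigO u.2 x y hxy m)) x

end Flat

/-! ### Generalized functions, vector fields and tensor fields on a manifold -/

section Manifold

variable {n : ℕ} {X : Type*} [TopologicalSpace X] [ChartedSpace (RSpace n) X]

/-- The open set `φ(V) ⊆ ℝⁿ` of a chart `(V, φ)`. -/
def chartImage (φ : OpenPartialHomeomorph X (RSpace n)) : TopologicalSpace.Opens (RSpace n) :=
  ⟨φ.target, φ.open_target⟩

variable (n X) in
/-- The smooth charts of `X`. -/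
abbrev charts : Set (OpenPartialHomeomorph X (RSpace n)) := IsManifold.maximalAtlas (𝓡 n) ∞ X

variable (n X) in
/-- Moderate nets of smooth functions on `X`. -/
def moderateFunM : Subring (Eps → C^∞⟮𝓡 n, X; ℝ⟯) where
  carrier := {u | ∀ φ ∈ charts n X, (fun ε y => u ε (φ.symm y)) ∈ moderateFun (chartImage φ)}
  zero_mem' φ _ := zero_mem (moderateFun (chartImage φ))
  one_mem' φ _ := one_mem (moderateFun (chartImage φ))
  add_mem' ha hb φ hφ := add_mem (ha φ hφ) (hb φ hφ)
  neg_mem' ha φ hφ := neg_mem (ha φ hφ)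
  mul_mem' ha hb φ hφ := mul_mem (ha φ hφ) (hb φ hφ)

/-- The local expression of a moderate net in a chart. -/
def moderateFunM.local (φ : OpenPartialHomeomorph X (RSpace n)) (hφ : φ ∈ charts n X) :
    moderateFunM n X →+* moderateFun (chartImage φ) where
  toFun u := ⟨fun ε y => u.1 ε (φ.symm y), u.2 φ hφ⟩
  map_zero' := rfl
  map_one' := rfl
  map_add' _ _ := rfl
  map_mul' _ _ := rfl

variable (n X) in
/-- Negligible nets of smooth functions on `X`. -/
def negligibleFunM : Ideal (moderateFunM n X) :=
  ⨅ φ : charts n X, (negligibleFun (chartImage φ.1)).comap (moderateFunM.local φ.1 φ.2)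

variable (n X) in
/-- The special Colombeau algebra `𝒢(X)`. -/
abbrev GFunM : Type _ := moderateFunM n X ⧸ negligibleFunM n X

variable [IsManifold (𝓡 n) ∞ X]

variable (n X) in
/-- Smooth vector fields on `X`. -/
abbrev SmoothVF : Type _ := Cₛ^∞⟮𝓡 n; RSpace n, (TangentSpace (𝓡 n) : X → Type _)⟯

variable (n X) in
/-- Smooth `(0,2)`-tensor fields on `X`: smooth sections of the bundle of bilinear forms on the
tangent spaces. -/
def SmoothTensor02 : Type _ :=
  Cₛ^∞⟮𝓡 n; RSpace n →L[ℝ] RSpace n →L[ℝ] ℝ,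
    fun x : X => TangentSpace (𝓡 n) x →L[ℝ] TangentSpace (𝓡 n) x →L[ℝ] ℝ⟯

instance : CoeFun (SmoothTensor02 n X)
    (fun _ => ∀ x : X, TangentSpace (𝓡 n) x →L[ℝ] TangentSpace (𝓡 n) x →L[ℝ] ℝ) :=
  ⟨fun g => ContMDiffSection.toFun g⟩

set_option synthInstance.maxHeartbeats 400000 in
/-- The pointwise addition of smooth tensor fields. -/
instance : AddCommGroup (SmoothTensor02 n X) := ContMDiffSection.instAddCommGroup

/-- The `i`-th component, in the chart `φ`, of a vector field. -/
def vfComp (φ : OpenPartialHomeomorph X (RSpace n)) (ξ : SmoothVF n X) (i : Fin n)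
    (y : RSpace n) : ℝ :=
  let w : RSpace n := mfderiv (𝓡 n) (𝓡 n) φ (φ.symm y) (ξ (φ.symm y))
  w i

/-- The `i`-th coordinate vector `∂_i` of the chart `φ` at the point with coordinates `y`. -/
def coordVec (φ : OpenPartialHomeomorph X (RSpace n)) (i : Fin n) (y : RSpace n) :
    TangentSpace (𝓡 n) (φ.symm y) :=
  mfderiv (𝓡 n) (𝓡 n) φ.symm y (EuclideanSpace.single i (1 : ℝ) : RSpace n)

/-- The component `g_{ij} = g(∂_i, ∂_j)`, in the chart `φ`, of a `(0,2)`-tensor field. -/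
def tensorComp (φ : OpenPartialHomeomorph X (RSpace n)) (g : SmoothTensor02 n X) (i j : Fin n)
    (y : RSpace n) : ℝ :=
  g (φ.symm y) (coordVec φ i y) (coordVec φ j y)

theorem sum_vfComp {φ : OpenPartialHomeomorph X (RSpace n)} (hφ : φ ∈ charts n X)
    (ξ : SmoothVF n X) {y : RSpace n} (hy : y ∈ φ.target) :
    ∑ i, vfComp φ ξ i y • coordVec φ i y = ξ (φ.symm y) := by
  have hd : φ.MDifferentiable (𝓡 n) (𝓡 n) :=
    ⟨(contMDiffOn_of_mem_maximalAtlas hφ).mdifferentiableOn (by simp),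
      (contMDiffOn_symm_of_mem_maximalAtlas hφ).mdifferentiableOn (by simp)⟩
  set w : RSpace n := mfderiv (𝓡 n) (𝓡 n) φ (φ.symm y) (ξ (φ.symm y)) with hw
  have h1 : (mfderiv (𝓡 n) (𝓡 n) φ.symm y : RSpace n →L[ℝ] RSpace n) w = ξ (φ.symm y) := by
    have h := DFunLike.congr_fun (hd.symm_comp_deriv (φ.map_target hy)) (ξ (φ.symm y))
    have hz : ∀ z : RSpace n, z = y →
        (mfderiv (𝓡 n) (𝓡 n) φ.symm z : RSpace n →L[ℝ] RSpace n) w =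
          (mfderiv (𝓡 n) (𝓡 n) φ.symm y : RSpace n →L[ℝ] RSpace n) w := by
      rintro _ rfl
      rfl
    exact (hz _ (φ.right_inv hy)).symm.trans h
  have h2 : w = ∑ i, w i • (EuclideanSpace.single i (1 : ℝ) : RSpace n) := by
    ext j
    simp [Finset.sum_apply, Pi.single_apply]
  have h3 : ∀ L : RSpace n →L[ℝ] RSpace n,
      L w = ∑ i, w i • L (EuclideanSpace.single i (1 : ℝ)) := fun L => by
    conv_lhs => rw [h2, map_sum]
    exact Finset.sum_congr rfl fun i _ => map_smul _ _ _
  exact ((h3 _).symm.trans h1)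

theorem tensor_eq_sum {φ : OpenPartialHomeomorph X (RSpace n)} (hφ : φ ∈ charts n X)
    (g : SmoothTensor02 n X) (ξ η : SmoothVF n X) {y : RSpace n} (hy : y ∈ φ.target) :
    g (φ.symm y) (ξ (φ.symm y)) (η (φ.symm y)) =
      ∑ i, ∑ j, tensorComp φ g i j y * vfComp φ ξ i y * vfComp φ η j y := by
  rw [← sum_vfComp hφ ξ hy, ← sum_vfComp hφ η hy]
  simp only [map_sum, map_smul, sum_apply, smul_apply, smul_eq_mul, tensorComp, Finset.mul_sum]
  rw [Finset.sum_comm]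
  refine Finset.sum_congr rfl fun i _ => Finset.sum_congr rfl fun j _ => ?_
  ring

/-- The smooth function `g(ξ, η)`. -/
def smoothPairing (g : SmoothTensor02 n X) (ξ η : SmoothVF n X) : C^∞⟮𝓡 n, X; ℝ⟯ :=
  ⟨fun x => g x (ξ x) (η x), fun x => by
    have := ContMDiffAt.clm_bundle_apply₂ (F₁ := RSpace n) (F₂ := RSpace n) (F₃ := ℝ)
      (E₃ := Bundle.Trivial X ℝ) (ContMDiffSection.contMDiff g x) (ξ.contMDiff x) (η.contMDiff x)
    simp only [contMDiffAt_totalSpace] at this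
    exact this.2⟩

theorem vfComp_zero (φ : OpenPartialHomeomorph X (RSpace n)) (i : Fin n) :
    vfComp φ (0 : SmoothVF n X) i = 0 := by
  funext y
  exact congrArg (fun w : RSpace n => w i)
    (map_zero (mfderiv (𝓡 n) (𝓡 n) φ (φ.symm y)))

theorem vfComp_add (φ : OpenPartialHomeomorph X (RSpace n)) (ξ η : SmoothVF n X) (i : Fin n) :
    vfComp φ (ξ + η) i = vfComp φ ξ i + vfComp φ η i := by
  funext y
  exact congrArg (fun w : RSpace n => w i)
    (map_add (mfderiv (𝓡 n) (𝓡 n) φ (φ.symm y)) (ξ (φ.symm y)) (η (φ.symm y)))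

theorem vfComp_neg (φ : OpenPartialHomeomorph X (RSpace n)) (ξ : SmoothVF n X) (i : Fin n) :
    vfComp φ (-ξ) i = -vfComp φ ξ i := by
  funext y
  exact congrArg (fun w : RSpace n => w i)
    (map_neg (mfderiv (𝓡 n) (𝓡 n) φ (φ.symm y)) (ξ (φ.symm y)))

variable (n X) in
/-- Moderate nets of smooth vector fields: all components in all charts are moderate. -/
def moderateVF : AddSubgroup (Eps → SmoothVF n X) where
  carrier := {ξ | ∀ φ ∈ charts n X, ∀ i,
    (fun ε => vfComp φ (ξ ε) i) ∈ moderateFun (chartImage φ)}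
  zero_mem' φ hφ i := by
    have : (fun ε => vfComp φ ((0 : Eps → SmoothVF n X) ε) i) = 0 :=
      funext fun _ => vfComp_zero φ i
    rw [this]
    exact zero_mem _
  add_mem' {a b} ha hb φ hφ i := by
    have : (fun ε => vfComp φ ((a + b) ε) i) =
        (fun ε => vfComp φ (a ε) i) + fun ε => vfComp φ (b ε) i :=
      funext fun _ => vfComp_add φ _ _ i
    rw [this]
    exact add_mem (ha φ hφ i) (hb φ hφ i)
  neg_mem' {a} ha φ hφ i := by
    have : (fun ε => vfComp φ ((-a) ε) i) = -fun ε => vfComp φ (a ε) i :=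
      funext fun _ => vfComp_neg φ _ i
    rw [this]
    exact neg_mem (ha φ hφ i)

/-- The `i`-th component of a moderate net of vector fields in a chart. -/
def moderateVF.comp (φ : OpenPartialHomeomorph X (RSpace n)) (hφ : φ ∈ charts n X) (i : Fin n) :
    moderateVF n X →+ moderateFun (chartImage φ) where
  toFun ξ := ⟨fun ε => vfComp φ (ξ.1 ε) i, ξ.2 φ hφ i⟩
  map_zero' := Subtype.ext (funext fun _ => vfComp_zero φ i)
  map_add' _ _ := Subtype.ext (funext fun _ => vfComp_add φ _ _ i)

variable (n X) in
/-- Negligible nets of smooth vector fields: all components in all charts are negligible. -/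
def negligibleVF : AddSubgroup (moderateVF n X) :=
  ⨅ (φ : charts n X) (i : Fin n),
    (negligibleFun (chartImage φ.1)).toAddSubgroup.comap (moderateVF.comp φ.1 φ.2 i)

variable (n X) in
/-- The space of generalized vector fields on `X`. -/
abbrev GVF : Type _ := moderateVF n X ⧸ negligibleVF n X

variable (n X) in
/-- Moderate nets of smooth `(0,2)`-tensor fields: all components in all charts are moderate. -/
def moderateTensor02 : AddSubgroup (Eps → SmoothTensor02 n X) where
  carrier := {g | ∀ φ ∈ charts n X, ∀ i j,
    (fun ε => tensorComp φ (g ε) i j) ∈ moderateFun (chartImage φ)}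
  zero_mem' φ _ _ _ := zero_mem (moderateFun (chartImage φ))
  add_mem' ha hb φ hφ i j := add_mem (ha φ hφ i j) (hb φ hφ i j)
  neg_mem' ha φ hφ i j := neg_mem (ha φ hφ i j)

/-- The component `g_{ij}` of a moderate net of `(0,2)`-tensor fields in a chart. -/
def moderateTensor02.comp (φ : OpenPartialHomeomorph X (RSpace n)) (hφ : φ ∈ charts n X)
    (i j : Fin n) : moderateTensor02 n X →+ moderateFun (chartImage φ) where
  toFun g := ⟨fun ε => tensorComp φ (g.1 ε) i j, g.2 φ hφ i j⟩
  map_zero' := rfl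
  map_add' _ _ := rfl

variable (n X) in
/-- Negligible nets of smooth `(0,2)`-tensor fields: all components in all charts are
negligible. -/
def negligibleTensor02 : AddSubgroup (moderateTensor02 n X) :=
  ⨅ (φ : charts n X) (i : Fin n) (j : Fin n),
    (negligibleFun (chartImage φ.1)).toAddSubgroup.comap (moderateTensor02.comp φ.1 φ.2 i j)

variable (n X) in
/-- The space `𝒢⁰₂(X)` of generalized `(0,2)`-tensor fields on `X`. -/
abbrev GTensor02 : Type _ := moderateTensor02 n X ⧸ negligibleTensor02 n X

/-- `(g_ε)_ε` is a representative of the generalized tensor field `g`. -/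
def IsRepresentative (gε : moderateTensor02 n X) (g : GTensor02 n X) : Prop :=
  (QuotientAddGroup.mk gε : GTensor02 n X) = g

/-! ### Operations on generalized tensor fields -/

/-- The matrix `(g_{ij})` of components in `𝒢(φ(V))` of a generalized `(0,2)`-tensor field, in the
chart `(V, φ)`. -/
def GTensor02.matrix (g : GTensor02 n X) (φ : OpenPartialHomeomorph X (RSpace n))
    (hφ : φ ∈ charts n X) : Matrix (Fin n) (Fin n) (GFun (chartImage φ)) :=
  Matrix.of fun i j => QuotientAddGroup.lift (negligibleTensor02 n X)
    ((Ideal.Quotient.mk (negligibleFun (chartImage φ))).toAddMonoidHom.comp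
      (moderateTensor02.comp φ hφ i j))
    (fun a ha => by
      simp only [negligibleTensor02, AddSubgroup.mem_iInf] at ha
      exact Ideal.Quotient.eq_zero_iff_mem.2 (ha ⟨φ, hφ⟩ i j)) g

/-- The bilinear form `g_φ(x̃) : ℝ̃ⁿ × ℝ̃ⁿ → ℝ̃`, `(v, w) ↦ ∑ g_{ij}(x̃) v_i w_j`. -/
def GTensor02.formAt (g : GTensor02 n X) (φ : OpenPartialHomeomorph X (RSpace n))
    (hφ : φ ∈ charts n X) (x : GPoint (chartImage φ)) :
    LinearMap.BilinForm GReal (Fin n → GReal) :=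
  Matrix.toBilin' ((g.matrix φ hφ).map (pointValue x))

theorem local_pairing_congr (g : moderateTensor02 n X) (ξ η : moderateVF n X)
    (φ : OpenPartialHomeomorph X (RSpace n)) (hφ : φ ∈ charts n X) (ε : Eps) :
    EqOn ((∑ i, ∑ j, moderateTensor02.comp φ hφ i j g * moderateVF.comp φ hφ i ξ *
        moderateVF.comp φ hφ j η : moderateFun (chartImage φ)).1 ε)
      (fun y => smoothPairing (g.1 ε) (ξ.1 ε) (η.1 ε) (φ.symm y)) (chartImage φ) := by
  intro y hy
  have h := tensor_eq_sum hφ (g.1 ε) (ξ.1 ε) (η.1 ε) hy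
  refine Eq.trans ?_ h.symm
  simp only [AddSubmonoidClass.coe_finsetSum, Finset.sum_apply]
  rfl

/-- The net `(g_ε(ξ_ε, η_ε))_ε`. -/
def netPairing (g : moderateTensor02 n X) (ξ η : moderateVF n X) : moderateFunM n X :=
  ⟨fun ε => smoothPairing (g.1 ε) (ξ.1 ε) (η.1 ε), fun φ hφ => by
    have hmem := (∑ i, ∑ j, moderateTensor02.comp φ hφ i j g * moderateVF.comp φ hφ i ξ *
        moderateVF.comp φ hφ j η : moderateFun (chartImage φ)).2
    have heq := local_pairing_congr g ξ η φ hφ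
    exact ⟨fun ε => (hmem.1 ε).congr (heq ε).symm, hmem.2.congr heq⟩⟩

theorem mk_local_netPairing (g : moderateTensor02 n X) (ξ η : moderateVF n X)
    (φ : OpenPartialHomeomorph X (RSpace n)) (hφ : φ ∈ charts n X) :
    Ideal.Quotient.mk (negligibleFun (chartImage φ))
        (moderateFunM.local φ hφ (netPairing g ξ η)) =
      ∑ i, ∑ j, Ideal.Quotient.mk (negligibleFun (chartImage φ))
          (moderateTensor02.comp φ hφ i j g) *
        Ideal.Quotient.mk (negligibleFun (chartImage φ)) (moderateVF.comp φ hφ i ξ) *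
        Ideal.Quotient.mk (negligibleFun (chartImage φ)) (moderateVF.comp φ hφ j η) := by
  simp only [← map_mul, ← map_sum]
  refine Ideal.Quotient.eq.2 (IsNegligible.congr isNegligible_zero fun ε y hy => ?_)
  exact (sub_eq_zero.2 (local_pairing_congr g ξ η φ hφ ε hy).symm).symm

theorem mk_netPairing_congr {g g' : moderateTensor02 n X} {ξ ξ' η η' : moderateVF n X}
    (hg : -g + g' ∈ negligibleTensor02 n X) (hξ : -ξ + ξ' ∈ negligibleVF n X)
    (hη : -η + η' ∈ negligibleVF n X) :
    Ideal.Quotient.mk (negligibleFunM n X) (netPairing g ξ η) =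
      Ideal.Quotient.mk (negligibleFunM n X) (netPairing g' ξ' η') := by
  simp only [negligibleTensor02, negligibleVF, AddSubgroup.mem_iInf] at hg hξ hη
  rw [Ideal.Quotient.eq, negligibleFunM, Submodule.mem_iInf]
  rintro ⟨φ, hφ⟩
  rw [Ideal.mem_comap, map_sub, ← Ideal.Quotient.eq, mk_local_netPairing, mk_local_netPairing]
  have key : ∀ {a b : moderateFun (chartImage φ)}, -a + b ∈ negligibleFun (chartImage φ) →
      Ideal.Quotient.mk (negligibleFun (chartImage φ)) a =
        Ideal.Quotient.mk (negligibleFun (chartImage φ)) b := fun {a b} h =>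
    (Ideal.Quotient.eq.2 (by rwa [neg_add_eq_sub] at h)).symm
  refine Finset.sum_congr rfl fun i _ => Finset.sum_congr rfl fun j _ => ?_
  have h1 := key (by have := hg ⟨φ, hφ⟩ i j; rwa [AddSubgroup.mem_comap, map_add, map_neg] at this)
  have h2 := key (by have := hξ ⟨φ, hφ⟩ i; rwa [AddSubgroup.mem_comap, map_add, map_neg] at this)
  have h3 := key (by have := hη ⟨φ, hφ⟩ j; rwa [AddSubgroup.mem_comap, map_add, map_neg] at this)
  rw [h1, h2, h3]

/-- The map `(ξ, η) ↦ g(ξ, η) = [(g_ε(ξ_ε, η_ε))_ε]` from pairs of generalized vector fields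
to `𝒢(X)`. -/
def GTensor02.pairing (g : GTensor02 n X) (ξ η : GVF n X) : GFunM n X :=
  Quotient.liftOn g
    (fun g' => Quotient.liftOn₂ ξ η
      (fun ξ' η' => Ideal.Quotient.mk (negligibleFunM n X) (netPairing g' ξ' η'))
      (fun _ _ _ _ h h' => mk_netPairing_congr (by simp [zero_mem])
        (QuotientAddGroup.leftRel_apply.1 h) (QuotientAddGroup.leftRel_apply.1 h')))
    (fun _ _ h => by
      refine Quotient.inductionOn₂ ξ η fun ξ' η' => ?_
      exact mk_netPairing_congr (QuotientAddGroup.leftRel_apply.1 h)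
        (by simp [zero_mem]) (by simp [zero_mem]))

/-- `g : 𝒢(X,TX) × 𝒢(X,TX) → 𝒢(X)` is symmetric. -/
def GTensor02.IsSymmetric (g : GTensor02 n X) : Prop :=
  ∀ ξ η : GVF n X, g.pairing ξ η = g.pairing η ξ

/-- `det g` is invertible in `𝒢(φ(V))` for every chart `(V, φ)`. -/
def GTensor02.DetInvertible (g : GTensor02 n X) : Prop :=
  ∀ (φ : OpenPartialHomeomorph X (RSpace n)) (hφ : φ ∈ charts n X), IsUnit (g.matrix φ hφ).det

/-- The smooth tensor field `h` restricts to a pseudo-Riemannian metric on `V`: it is symmetric and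
non-degenerate on every tangent space over `V`. (By continuity its index is then locally constant
on `V`.) -/
def IsPseudoRiemannianOn (h : SmoothTensor02 n X) (V : Set X) : Prop :=
  ∀ p ∈ V, (∀ v w : TangentSpace (𝓡 n) p, h p v w = h p w v) ∧
    ∀ v : TangentSpace (𝓡 n) p, (∀ w : TangentSpace (𝓡 n) p, h p v w = 0) → v = 0

end Manifold

end Colombeau

end

noncomputable section
namespace Colombeau

instance epsZero_neBot : epsZero.NeBot := by
  refine comap_neBot fun t ht => ?_
  obtain ⟨δ, hδ, h⟩ := Metric.mem_nhds_iff.1 ht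
  have hp : 0 < min (δ / 2) 1 := by positivity
  refine ⟨⟨min (δ / 2) 1, hp, min_le_right _ _⟩, h ?_⟩
  rw [Metric.mem_ball, dist_zero_right, Real.norm_of_nonneg hp.le]
  exact (min_le_left _ _).trans_lt (by linarith)

theorem eventually_epsZero_iff {P : Eps → Prop} :
    (∀ᶠ ε in epsZero, P ε) ↔ ∃ ε₀ : ℝ, 0 < ε₀ ∧ ∀ ε : Eps, (ε : ℝ) < ε₀ → P ε := by
  rw [epsZero, Metric.nhds_basis_ball.comap _ |>.eventually_iff]
  refine exists_congr fun δ => and_congr_right fun _ => forall_congr' fun ε => ?_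
  rw [mem_preimage, Metric.mem_ball, dist_zero_right, Real.norm_of_nonneg ε.pos.le]

/-- A bound for the derivative at a point in terms of bounds for a function and the Lipschitz
constant of its derivative. -/
theorem norm_le_of_lipschitz_deriv {E F : Type*} [NormedAddCommGroup E] [NormedSpace ℝ E]
    [NormedAddCommGroup F] [NormedSpace ℝ F] {f : E → F} {f' : E → E →L[ℝ] F} {x : E}
    {A B h : ℝ} (hh : 0 < h) (hA : 0 ≤ A) (hB : 0 ≤ B)
    (hf : ∀ z ∈ Metric.closedBall x h, HasFDerivAt f (f' z) z)
    (hfA : ∀ z ∈ Metric.closedBall x h, ‖f z‖ ≤ A)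
    (hfB : ∀ z ∈ Metric.closedBall x h, ‖f' z - f' x‖ ≤ B * ‖z - x‖) :
    ‖f' x‖ ≤ 2 * A / h + B * h := by
  refine ContinuousLinearMap.opNorm_le_of_unit_norm (by positivity) fun v hv => ?_
  have hx : x ∈ Metric.closedBall x h := Metric.mem_closedBall_self hh.le
  have hy : x + h • v ∈ Metric.closedBall x h := by
    simp [Metric.mem_closedBall, dist_eq_norm, norm_smul, hv, abs_of_pos hh]
  have key := (convex_closedBall x h).norm_image_sub_le_of_norm_hasFDerivWithin_le'
    (f := f) (f' := f') (φ := f' x) (C := B * h) (x := x) (y := x + h • v)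
    (fun z hz => (hf z hz).hasFDerivWithinAt)
    (fun z hz => (hfB z hz).trans (by
      gcongr
      rwa [← dist_eq_norm, ← Metric.mem_closedBall])) hx hy
  rw [add_sub_cancel_left, norm_smul, hv, mul_one, Real.norm_of_nonneg hh.le, map_smul] at key
  have h2 : h * ‖f' x v‖ ≤ 2 * A + B * h * h := by
    calc h * ‖f' x v‖ = ‖h • f' x v‖ := by rw [norm_smul, Real.norm_of_nonneg hh.le]
      _ = ‖f (x + h • v) - f x - (f (x + h • v) - f x - h • f' x v)‖ := by congr 1; abel
      _ ≤ ‖f (x + h • v) - f x‖ + ‖f (x + h • v) - f x - h • f' x v‖ := norm_sub_le _ _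
      _ ≤ (A + A) + B * h * h :=
        add_le_add ((norm_sub_le _ _).trans (add_le_add (hfA _ hy) (hfA _ hx))) key
      _ = _ := by ring
  have h3 : 2 * A / h + B * h = (2 * A + B * h * h) / h := by field_simp
  rw [h3, le_div_iff₀ hh]
  linarith

section Flat

variable {n : ℕ} {Ω : TopologicalSpace.Opens (RSpace n)} {u v w : Eps → RSpace n → ℝ}
  {K : Set (RSpace n)} {k : ℕ} {r s : ℤ}

theorem norm_eps_zpow (ε : Eps) (r : ℤ) : ‖(ε : ℝ) ^ r‖ = (ε : ℝ) ^ r :=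
  Real.norm_of_nonneg (zpow_nonneg ε.pos.le _)

theorem eps_zpow_le (ε : Eps) (h : r ≤ s) : (ε : ℝ) ^ s ≤ (ε : ℝ) ^ r :=
  zpow_le_zpow_right_of_le_one₀ ε.pos ε.2.2 h

theorem eventually_const_mul_eps_lt (C : ℝ) {δ : ℝ} (hδ : 0 < δ) :
    ∀ᶠ ε : Eps in epsZero, C * (ε : ℝ) < δ := by
  have := tendsto_eps.const_mul C
  rw [mul_zero] at this
  exact this.eventually_lt_const hδ

theorem HasOrder.eventually_le (h : HasOrder Ω u K k r) :
    ∃ C : ℝ, 0 < C ∧ ∀ᶠ ε : Eps in epsZero, ∀ x ∈ K,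
      ‖iteratedFDerivWithin ℝ k (u ε) Ω x‖ ≤ C * (ε : ℝ) ^ r := by
  obtain ⟨C, hC, h⟩ := Asymptotics.IsBigO.exists_pos h
  have h := h.bound
  rw [eventually_prod_principal_iff] at h
  refine ⟨C, hC, h.mono fun ε hε x hx => ?_⟩
  simpa only [norm_eps_zpow] using hε x hx

theorem hasOrder_of_eventually_le (C : ℝ) (h : ∀ᶠ ε : Eps in epsZero, ∀ x ∈ K,
      ‖iteratedFDerivWithin ℝ k (u ε) Ω x‖ ≤ C * (ε : ℝ) ^ r) : HasOrder Ω u K k r := by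
  refine Asymptotics.IsBigO.of_bound C ?_
  rw [eventually_prod_principal_iff]
  refine h.mono fun ε hε x hx => ?_
  simpa only [norm_eps_zpow] using hε x hx

/-- A net of smooth functions with moderate second derivatives whose `k`-th derivatives are
negligible has negligible `k+1`-st derivatives. -/
theorem HasOrder.succ_of_forall (hu : ∀ ε, ContDiffOn ℝ ∞ (u ε) Ω) (hmod : IsModerate Ω u)
    (h : ∀ K : Set (RSpace n), IsCompact K → K ⊆ Ω → ∀ m : ℕ, HasOrder Ω u K k m)
    (hc : IsCompact K) (hK : K ⊆ Ω) (m : ℕ) : HasOrder Ω u K (k + 1) m := by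
  obtain ⟨δ, hδ, hδΩ⟩ := hc.exists_cthickening_subset_open Ω.isOpen hK
  have hc' := hc.cthickening (r := δ)
  obtain ⟨N, hN⟩ := hmod _ hc' hδΩ (k + 2)
  obtain ⟨C₂, hC₂, h₂⟩ := hN.eventually_le
  obtain ⟨C₀, hC₀, h₀⟩ := (h _ hc' hδΩ (2 * m + N + 1)).eventually_le
  refine hasOrder_of_eventually_le (2 * C₀ + C₂) ?_
  filter_upwards [h₀, h₂, eventually_const_mul_eps_lt 1 hδ] with ε h₀ h₂ hεδ x hx
  rw [one_mul] at hεδ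
  have hh : (0 : ℝ) < (ε : ℝ) ^ (m + N + 1 : ℤ) := zpow_pos ε.pos _
  have hhδ : (ε : ℝ) ^ (m + N + 1 : ℤ) ≤ δ :=
    (eps_zpow_le ε (r := 1) (by omega)).trans (by simpa using hεδ.le)
  have hball : Metric.closedBall x ((ε : ℝ) ^ (m + N + 1 : ℤ)) ⊆ Metric.cthickening δ K :=
    (Metric.closedBall_subset_closedBall hhδ).trans (Metric.closedBall_subset_cthickening hx δ)
  have hd : ∀ j, ∀ z ∈ Metric.closedBall x ((ε : ℝ) ^ (m + N + 1 : ℤ)),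
      HasFDerivAt (iteratedFDerivWithin ℝ j (u ε) Ω)
        (fderivWithin ℝ (iteratedFDerivWithin ℝ j (u ε) Ω) Ω z) z := fun j z hz =>
    (((hu ε).differentiableOn_iteratedFDerivWithin (by exact_mod_cast ENat.natCast_lt_top j)
      Ω.isOpen.uniqueDiffOn) z (hδΩ (hball hz))).hasFDerivWithinAt.hasFDerivAt
      (Ω.isOpen.mem_nhds (hδΩ (hball hz)))
  have key := norm_le_of_lipschitz_deriv (A := C₀ * (ε : ℝ) ^ ((2 * m + N + 1 : ℕ) : ℤ))
    (B := C₂ * (ε : ℝ) ^ (-(N : ℤ))) hh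
    (mul_nonneg hC₀.le (zpow_nonneg ε.pos.le _)) (mul_nonneg hC₂.le (zpow_nonneg ε.pos.le _))
    (hd k) (fun z hz => h₀ z (hball hz)) (fun z hz => by
      have := Convex.norm_image_sub_le_of_norm_hasFDerivWithin_le
        (s := Metric.closedBall x ((ε : ℝ) ^ (m + N + 1 : ℤ)))
        (f := iteratedFDerivWithin ℝ (k + 1) (u ε) Ω)
        (f' := fderivWithin ℝ (iteratedFDerivWithin ℝ (k + 1) (u ε) Ω) Ω)
        (C := C₂ * (ε : ℝ) ^ (-(N : ℤ))) (x := x) (y := z)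
        (fun y hy => (hd (k + 1) y hy).hasFDerivWithinAt)
        (fun y hy => by
          rw [norm_fderivWithin_iteratedFDerivWithin]
          exact h₂ y (hball hy))
        (convex_closedBall x _)
        (Metric.mem_closedBall_self hh.le) hz
      rwa [iteratedFDerivWithin_succ_eq_comp_left, Function.comp_apply, Function.comp_apply,
        ← dist_eq_norm, LinearIsometryEquiv.dist_map, dist_eq_norm] at this)
  rw [norm_fderivWithin_iteratedFDerivWithin] at key
  refine key.trans ?_
  have e1 : 2 * (C₀ * (ε : ℝ) ^ ((2 * m + N + 1 : ℕ) : ℤ)) / (ε : ℝ) ^ (m + N + 1 : ℤ) =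
      2 * C₀ * (ε : ℝ) ^ (m : ℤ) := by
    rw [← mul_assoc, mul_div_assoc, ← zpow_sub₀ ε.ne_zero]
    congr 2
    push_cast
    ring
  have e2 : C₂ * (ε : ℝ) ^ (-(N : ℤ)) * (ε : ℝ) ^ (m + N + 1 : ℤ) ≤ C₂ * (ε : ℝ) ^ (m : ℤ) := by
    rw [mul_assoc, ← zpow_add₀ ε.ne_zero]
    exact mul_le_mul_of_nonneg_left (eps_zpow_le ε (by omega)) hC₂.le
  rw [e1, add_mul]
  exact add_le_add_right e2 _

/-- A moderate net is negligible as soon as its values are. -/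
theorem IsModerate.isNegligible_of_order_zero (hu : ∀ ε, ContDiffOn ℝ ∞ (u ε) Ω)
    (hmod : IsModerate Ω u)
    (h : ∀ K : Set (RSpace n), IsCompact K → K ⊆ Ω → ∀ m : ℕ, HasOrder Ω u K 0 m) :
    IsNegligible Ω u := by
  intro K hc hK k
  induction k generalizing K with
  | zero => exact h K hc hK
  | succ k ih => exact HasOrder.succ_of_forall hu hmod (fun K hc hK => ih K hc hK) hc hK

theorem hasOrder_zero_of_eventually_le (C : ℝ) (h : ∀ᶠ ε : Eps in epsZero, ∀ x ∈ K,
      |u ε x| ≤ C * (ε : ℝ) ^ r) : HasOrder Ω u K 0 r :=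
  hasOrder_of_eventually_le C (h.mono fun ε hε x hx => by
    simpa only [norm_iteratedFDerivWithin_zero, Real.norm_eq_abs] using hε x hx)

theorem HasOrder.eventually_abs_le (h : HasOrder Ω u K 0 r) :
    ∃ C : ℝ, 0 < C ∧ ∀ᶠ ε : Eps in epsZero, ∀ x ∈ K, |u ε x| ≤ C * (ε : ℝ) ^ r := by
  simpa only [norm_iteratedFDerivWithin_zero, Real.norm_eq_abs] using h.eventually_le

/-- A net which is constant in the space variable. -/
theorem hasOrder_const {c : Eps → ℝ} (h : c =O[epsZero] (fun ε : Eps => (ε : ℝ) ^ r)) (k : ℕ) :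
    HasOrder Ω (fun ε _ => c ε) K k r := by
  rcases Nat.eq_zero_or_pos k with rfl | hk
  · obtain ⟨C, hC⟩ := h.bound
    refine hasOrder_zero_of_eventually_le C (hC.mono fun ε hε x _ => ?_)
    rwa [norm_eps_zpow, Real.norm_eq_abs] at hε
  · refine (Asymptotics.isBigO_zero _ _).congr' (f₁ := fun _ => 0) ?_ EventuallyEq.rfl
    filter_upwards with p
    rw [iteratedFDerivWithin_const_of_ne hk.ne']
    rfl

/-- A net which does not depend on `ε` is moderate. -/
theorem isModerate_of_contDiffOn {f : RSpace n → ℝ} (hf : ContDiffOn ℝ ∞ f Ω) :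
    IsModerate Ω (fun _ => f) := by
  intro K hc hK k
  have hcont : ContinuousOn (iteratedFDerivWithin ℝ k f Ω) K :=
    (hf.continuousOn_iteratedFDerivWithin (by exact_mod_cast le_top)
      Ω.isOpen.uniqueDiffOn).mono hK
  obtain ⟨C, hC⟩ := hc.exists_bound_of_continuousOn hcont
  exact ⟨0, hasOrder_of_eventually_le C (Eventually.of_forall fun ε x hx => by simpa using hC x hx)⟩

/-- Nets of functions bounded below by a power of `ε`, uniformly on compact subsets of `Ω`. -/
def IsBoundedBelow (Ω : TopologicalSpace.Opens (RSpace n)) (u : Eps → RSpace n → ℝ) : Prop :=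
  ∀ K : Set (RSpace n), IsCompact K → K ⊆ Ω →
    ∃ N : ℕ, ∀ᶠ ε : Eps in epsZero, ∀ x ∈ K, (ε : ℝ) ^ (N : ℤ) ≤ |u ε x|

theorem IsModerate.inv (hw : ∀ ε, ContDiffOn ℝ ∞ (w ε) Ω) (hmod : IsModerate Ω w)
    (h0 : ∀ ε, ∀ x ∈ Ω, w ε x ≠ 0) (hb : IsBoundedBelow Ω w) : IsModerate Ω w⁻¹ := by
  have hwi : ∀ ε, ContDiffOn ℝ ∞ (w⁻¹ ε) Ω := fun ε => (hw ε).inv (h0 ε)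
  intro K hc hK k
  induction k using Nat.strong_induction_on with
  | _ k ih =>
  rcases k with _ | k
  · obtain ⟨N, hN⟩ := hb K hc hK
    refine ⟨N, hasOrder_zero_of_eventually_le 1 (hN.mono fun ε hε x hx => ?_)⟩
    rw [Pi.inv_apply, Pi.inv_apply, abs_inv, zpow_neg, one_mul]
    exact inv_anti₀ (zpow_pos ε.pos _) (hε x hx)
  have ih' : ∃ N : ℕ, ∀ i ≤ k, HasOrder Ω w⁻¹ K i (-(N : ℤ)) := by
    choose N hN using ih
    refine ⟨∑ i : Fin (k + 1), N i i.2, fun i hi => (hN i (by omega)).mono ?_⟩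
    have : N i (by omega) ≤ ∑ i : Fin (k + 1), N i i.2 :=
      Finset.single_le_sum (f := fun i : Fin (k + 1) => N i i.2) (fun _ _ => Nat.zero_le _)
        (Finset.mem_univ ⟨i, Nat.lt_succ_of_le hi⟩)
    omega
  obtain ⟨N, hN⟩ := ih'
  obtain ⟨M, hM⟩ := hmod.exists_uniform hc hK (k + 1)
  have hf : ∀ i ≤ k, HasOrder Ω (-(w⁻¹ * w⁻¹)) K i (-(N : ℤ) + -(N : ℤ)) := fun i hi =>
    (HasOrder.mul hwi hwi hK (fun j hj => hN j (hj.trans hi))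
      (fun j hj => hN j (hj.trans hi))).neg hK
  refine ⟨2 * N + M, ?_⟩
  have key : (fun p : Eps × RSpace n => ∑ i ∈ Finset.range (k + 1),
      (k.choose i : ℝ) * ‖iteratedFDerivWithin ℝ i ((-(w⁻¹ * w⁻¹)) p.1) Ω p.2‖ *
        ‖iteratedFDerivWithin ℝ (k - i + 1) (w p.1) Ω p.2‖)
      =O[epsZero ×ˢ 𝓟 K] (fun p : Eps × RSpace n => (p.1 : ℝ) ^ (-((2 * N + M : ℕ) : ℤ))) := by
    refine Asymptotics.IsBigO.fun_sum fun i hi => ?_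
    have h1 := Asymptotics.IsBigO.norm_left (hf i (Nat.lt_succ_iff.1 (Finset.mem_range.1 hi)))
    have h2 := Asymptotics.IsBigO.norm_left (hM (k - i + 1) (by omega))
    refine ((h1.const_mul_left (k.choose i : ℝ)).mul h2).congr_right fun p => ?_
    rw [← zpow_add₀ p.1.ne_zero]
    congr 1
    push_cast
    ring
  refine Asymptotics.IsBigO.trans (Asymptotics.IsBigO.of_bound 1 ?_) key
  filter_upwards [eventually_mem epsZero K] with p hp
  rw [one_mul]
  refine le_trans ?_ (Real.le_norm_self _)
  have hx : p.2 ∈ (Ω : Set (RSpace n)) := hK hp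
  have hU := Ω.isOpen.uniqueDiffOn (𝕜 := ℝ)
  have hderiv : EqOn (fderivWithin ℝ (w⁻¹ p.1) Ω)
      (fun x => (-(w⁻¹ * w⁻¹)) p.1 x • fderivWithin ℝ (w p.1) Ω x) Ω := fun x hx => by
    have hd := ((hw p.1).differentiableOn (by simp) x hx).hasFDerivWithinAt
    refine ((hasDerivAt_inv (h0 p.1 x hx)).comp_hasFDerivWithinAt x hd).fderivWithin (hU x hx)
      |>.trans ?_
    simp only [Pi.neg_apply, Pi.mul_apply, Pi.inv_apply, sq, mul_inv]
  rw [← norm_iteratedFDerivWithin_fderivWithin hU hx, iteratedFDerivWithin_congr hderiv hx]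
  refine (norm_iteratedFDerivWithin_smul_le (N := ∞) (((hwi p.1).mul (hwi p.1)).neg)
    ((hw p.1).fderivWithin hU (by simp)) hU hx (by exact_mod_cast le_top)).trans_eq ?_
  refine Finset.sum_congr rfl fun i _ => ?_
  rw [norm_iteratedFDerivWithin_fderivWithin hU hx]
  rfl

/-- A moderate net bounded below by powers of `ε` on compact sets is invertible. -/
theorem isUnit_mk_of_isBoundedBelow (u : moderateFun Ω) (hb : IsBoundedBelow Ω u.1) :
    IsUnit (Ideal.Quotient.mk (negligibleFun Ω) u) := by
  set c : Eps → RSpace n → ℝ := fun ε _ => Real.exp (-(ε : ℝ)⁻¹) with hc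
  have hcO : ∀ m : ℕ, (fun ε : Eps => Real.exp (-(ε : ℝ)⁻¹)) =O[epsZero]
      (fun ε : Eps => (ε : ℝ) ^ (m : ℤ)) := fun m => by
    refine Asymptotics.IsBigO.of_bound (m.factorial : ℝ) (Eventually.of_forall fun ε => ?_)
    rw [norm_eps_zpow, Real.norm_of_nonneg (Real.exp_pos _).le, Real.exp_neg, zpow_natCast]
    have := Real.pow_div_factorial_le_exp (ε : ℝ)⁻¹ (inv_nonneg.2 ε.pos.le) m
    have h2 : (0 : ℝ) < (ε : ℝ)⁻¹ ^ m / m.factorial := by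
      have := ε.pos
      positivity
    refine (inv_anti₀ h2 this).trans_eq ?_
    rw [inv_div, inv_pow, div_inv_eq_mul]
  have hcm : c ∈ moderateFun Ω :=
    ⟨fun _ => contDiffOn_const, fun K _ _ k => ⟨0, (hasOrder_const (hcO 0) k)⟩⟩
  have hcn : IsNegligible Ω c := fun K _ _ k m => hasOrder_const (hcO m) k
  set w : Eps → RSpace n → ℝ := u.1 * u.1 + c with hw
  have hwm : w ∈ moderateFun Ω := add_mem (mul_mem u.2 u.2) hcm
  have hge : ∀ ε x, u.1 ε x * u.1 ε x ≤ w ε x := fun ε x => by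
    change _ ≤ u.1 ε x * u.1 ε x + Real.exp (-(ε : ℝ)⁻¹)
    linarith [Real.exp_pos (-(ε : ℝ)⁻¹)]
  have hpos : ∀ ε x, 0 < w ε x := fun ε x =>
    add_pos_of_nonneg_of_pos (mul_self_nonneg (u.1 ε x)) (Real.exp_pos _)
  have hwi : w⁻¹ ∈ moderateFun Ω := by
    refine ⟨fun ε => (hwm.1 ε).inv fun x _ => (hpos ε x).ne',
      hwm.2.inv hwm.1 (fun ε x _ => (hpos ε x).ne') fun K hK hKΩ => ?_⟩
    obtain ⟨N, hN⟩ := hb K hK hKΩ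
    refine ⟨2 * N, hN.mono fun ε hε x hx => ?_⟩
    rw [abs_of_pos (hpos ε x)]
    refine le_trans ?_ (hge ε x)
    rw [← abs_mul_abs_self (u.1 ε x), Nat.cast_mul, Nat.cast_ofNat, two_mul, zpow_add₀ ε.ne_zero]
    exact mul_self_le_mul_self (zpow_nonneg ε.pos.le _) (hε x hx)
  refine IsUnit.of_mul_eq_one (Ideal.Quotient.mk _ (u * ⟨w⁻¹, hwi⟩)) ?_
  rw [← map_mul, ← map_one (Ideal.Quotient.mk (negligibleFun Ω)), Ideal.Quotient.eq]
  refine (IsNegligible.mul_left (neg_mem hwi) hcm.1 hcn).congr fun ε x _ => ?_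
  have hne := (hpos ε x).ne'
  change -(w ε x)⁻¹ * c ε x = u.1 ε x * (u.1 ε x * (w ε x)⁻¹) - 1
  field_simp
  change -c ε x = u.1 ε x ^ 2 - (u.1 ε x * u.1 ε x + c ε x)
  ring

theorem eventually_ne_zero_of_isUnit_mk {u : moderateFun Ω}
    (hu : IsUnit (Ideal.Quotient.mk (negligibleFun Ω) u)) (hc : IsCompact K) (hK : K ⊆ Ω) :
    ∀ᶠ ε : Eps in epsZero, ∀ x ∈ K, u.1 ε x ≠ 0 := by
  obtain ⟨b, hb⟩ := hu.exists_right_inv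
  obtain ⟨v, rfl⟩ := Ideal.Quotient.mk_surjective b
  rw [← map_mul, ← map_one (Ideal.Quotient.mk (negligibleFun Ω)), Ideal.Quotient.eq] at hb
  obtain ⟨C, -, hC⟩ := (hb K hc hK 0 1).eventually_abs_le
  filter_upwards [hC, eventually_const_mul_eps_lt C one_pos] with ε h1 h2 x hx h0
  have := h1 x hx
  have e : (u * v - 1 : moderateFun Ω).1 ε x = u.1 ε x * v.1 ε x - 1 := rfl
  rw [e, h0] at this
  simp at this
  linarith

theorem exists_compactNet_forall_le (hc : IsCompact K) (hK : K ⊆ Ω) (hne : K.Nonempty)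
    (f : Eps → RSpace n → ℝ) (hf : ∀ ε, ContinuousOn (f ε) K) :
    ∃ x : CompactNet Ω, ∀ ε, x.1 ε ∈ K ∧ ∀ y ∈ K, f ε y ≤ f ε (x.1 ε) := by
  choose x hxK hx using fun ε => hc.exists_isMaxOn hne (hf ε)
  exact ⟨⟨x, fun ε => hK (hxK ε), K, hc, hK, Eventually.of_forall hxK⟩,
    fun ε => ⟨hxK ε, fun y hy => hx ε hy⟩⟩

theorem isNegligible_of_forall_compactNet (hu : u ∈ moderateFun Ω)
    (h : ∀ x : CompactNet Ω, ∀ m : ℕ,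
      (fun ε => u ε (x.1 ε)) =O[epsZero] (fun ε : Eps => (ε : ℝ) ^ (m : ℤ))) :
    IsNegligible Ω u := by
  refine hu.2.isNegligible_of_order_zero hu.1 fun K hc hK m => ?_
  rcases K.eq_empty_or_nonempty with rfl | hne
  · exact hasOrder_zero_of_eventually_le 0 (by simp)
  obtain ⟨x, hx⟩ := exists_compactNet_forall_le hc hK hne (fun ε y => |u ε y|)
    fun ε => ((hu.1 ε).continuousOn.mono hK).abs
  obtain ⟨C, hC⟩ := (h x m).bound
  refine hasOrder_zero_of_eventually_le C (hC.mono fun ε hε y hy => ?_)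
  rw [norm_eps_zpow] at hε
  exact ((hx ε).2 y hy).trans hε

/-- Generalized functions are determined by their point values. -/
theorem eq_of_forall_pointValue_eq {a b : GFun Ω}
    (h : ∀ x : GPoint Ω, pointValue x a = pointValue x b) : a = b := by
  obtain ⟨u, rfl⟩ := Ideal.Quotient.mk_surjective a
  obtain ⟨v, rfl⟩ := Ideal.Quotient.mk_surjective b
  refine Ideal.Quotient.eq.2 (isNegligible_of_forall_compactNet (u - v).2 fun x m => ?_)
  exact Ideal.Quotient.eq.1 (h (Quotient.mk _ x)) m

end Flat

end Colombeau


/-- A real matrix of small determinant maps some unit vector to a short vector. -/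
theorem Matrix.exists_norm_eq_one_abs_vecMul_lt {n : ℕ} (A : Matrix (Fin n) (Fin n) ℝ) {c : ℝ}
    (hc : 0 < c) (h : n.factorial * |A.det| < c ^ n) :
    ∃ v : Fin n → ℝ, ‖v‖ = 1 ∧ ∀ j, |(Matrix.vecMul v A) j| < c := by
  by_contra! hcon
  have hbound : ∀ v : Fin n → ℝ, c * ‖v‖ ≤ ‖Matrix.vecMul v A‖ := fun v => by
    rcases eq_or_ne v 0 with rfl | hv
    · simp
    have hv' : 0 < ‖v‖ := norm_pos_iff.2 hv
    obtain ⟨j, hj⟩ := hcon (‖v‖⁻¹ • v) (by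
      rw [norm_smul, norm_inv, norm_norm, inv_mul_cancel₀ hv'.ne'])
    rw [Matrix.smul_vecMul, Pi.smul_apply, smul_eq_mul, abs_mul, abs_of_pos (inv_pos.2 hv'),
      inv_mul_eq_div, le_div_iff₀ hv'] at hj
    exact hj.trans (norm_le_pi_norm (Matrix.vecMul v A) j)
  have hdet : A.det ≠ 0 := fun h0 => by
    obtain ⟨v, hv, hv0⟩ := Matrix.exists_vecMul_eq_zero_iff.2 h0
    have := hbound v
    rw [hv0, norm_zero] at this
    exact absurd this (not_le.2 (mul_pos hc (norm_pos_iff.2 hv)))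
  have hunit : IsUnit A.det := isUnit_iff_ne_zero.2 hdet
  have hentry : ∀ i j, |A⁻¹ i j| ≤ c⁻¹ := fun i j => by
    have h1 := hbound (A⁻¹.row i)
    have h2 : Matrix.vecMul (A⁻¹.row i) A = Pi.single i 1 := by
      rw [← Matrix.single_one_vecMul, Matrix.vecMul_vecMul, Matrix.nonsing_inv_mul A hunit,
        Matrix.vecMul_one]
    rw [h2, Pi.norm_single, norm_one] at h1
    refine (norm_le_pi_norm (A⁻¹.row i) j).trans ?_
    rwa [← one_div c, le_div_iff₀' hc]
  have h3 := Matrix.det_le (A := A⁻¹) (abv := AbsoluteValue.abs) (x := c⁻¹) hentry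
  rw [AbsoluteValue.abs_apply, Fintype.card_fin, nsmul_eq_mul, Matrix.det_nonsing_inv,
    Ring.inverse_eq_inv', abs_inv, inv_pow, ← div_eq_mul_inv,
    inv_le_comm₀ (abs_pos.2 hdet) (by positivity), inv_div,
    div_le_iff₀' (by positivity)] at h3
  exact absurd h3 (not_le.2 h)

namespace Colombeau

/-- The determinant of a matrix of generalized numbers which annihilates no nonzero vector is
bounded below by a power of `ε`. -/
theorem eventually_le_abs_det {n : ℕ} (M : Matrix (Fin n) (Fin n) moderateReal)
    (hM : ∀ v, Matrix.vecMul v (M.map (Ideal.Quotient.mk negligibleReal)) = 0 → v = 0) :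
    ∃ N : ℕ, ∀ᶠ ε : Eps in epsZero, (ε : ℝ) ^ (N : ℤ) ≤ |(M.map fun a => a.1 ε).det| := by
  by_contra! hcon
  have hseq : ∀ k : ℕ, ∃ ε : Eps, (ε : ℝ) < 1 / ((k : ℝ) + 1) ∧ ∃ v : Fin n → ℝ, ‖v‖ = 1 ∧
      ∀ j, |Matrix.vecMul v (M.map fun a => a.1 ε) j| < (ε : ℝ) ^ (k : ℤ) := fun k => by
    have h1 := eventually_const_mul_eps_lt (n.factorial : ℝ) one_pos
    have h2 := eventually_const_mul_eps_lt 1 (δ := 1 / ((k : ℝ) + 1)) (by positivity)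
    obtain ⟨ε, hε, h1, h2⟩ :=
      ((hcon (k * n + 1)).and_eventually (h1.and h2)).exists
    refine ⟨ε, by simpa using h2,
      Matrix.exists_norm_eq_one_abs_vecMul_lt _ (zpow_pos ε.pos _) ?_⟩
    have hpos := ε.pos
    calc (n.factorial : ℝ) * |(M.map fun a => a.1 ε).det|
        < n.factorial * (ε : ℝ) ^ ((k * n + 1 : ℕ) : ℤ) := by gcongr
      _ = (n.factorial * (ε : ℝ)) * ((ε : ℝ) ^ (k : ℤ)) ^ n := by
        rw [zpow_natCast, zpow_natCast, pow_succ, pow_mul]; ring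
      _ ≤ 1 * ((ε : ℝ) ^ (k : ℤ)) ^ n := by gcongr
      _ = _ := one_mul _
  choose e he v hv hvA using hseq
  classical
  let s : Eps → Fin n → ℝ := fun ε => if h : ∃ k, e k = ε then v h.choose else 0
  have hs1 : ∀ ε i, |s ε i| ≤ 1 := fun ε i => by
    refine (norm_le_pi_norm (s ε) i).trans ?_
    by_cases h : ∃ k, e k = ε
    · simp only [s, dif_pos h, hv, le_refl]
    · simp [s, dif_neg h]
  have hsA : ∀ m : ℕ, ∀ᶠ ε : Eps in epsZero, ∀ j,
      |Matrix.vecMul (s ε) (M.map fun a => a.1 ε) j| ≤ (ε : ℝ) ^ (m : ℤ) := fun m => by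
    have hlarge : ∀ᶠ ε : Eps in epsZero, ∀ k ∈ Finset.range m, e k ≠ ε := by
      rw [Filter.eventually_all_finset]
      intro k _
      filter_upwards [eventually_const_mul_eps_lt 1 (e k).pos] with ε hε h
      rw [h, one_mul] at hε
      exact lt_irrefl _ hε
    filter_upwards [hlarge] with ε hε j
    by_cases h : ∃ k, e k = ε
    · simp only [s, dif_pos h]
      have hk := h.choose_spec
      have hmk : m ≤ h.choose := by
        by_contra! hlt
        exact hε _ (Finset.mem_range.2 hlt) hk
      have := hvA h.choose j
      rw [hk] at this
      exact this.le.trans (eps_zpow_le ε (by exact_mod_cast hmk))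
    · simp only [s, dif_neg h, Matrix.zero_vecMul, Pi.zero_apply, abs_zero]
      exact zpow_nonneg ε.pos.le _
  let S : Fin n → moderateReal := fun i => ⟨fun ε => s ε i, 0,
    Asymptotics.IsBigO.of_bound 1 (Eventually.of_forall fun ε => by simpa using hs1 ε i)⟩
  have hS := hM (fun i => Ideal.Quotient.mk _ (S i)) (funext fun j => by
    have h1 : Matrix.vecMul (fun i => Ideal.Quotient.mk negligibleReal (S i))
        (M.map (Ideal.Quotient.mk negligibleReal)) j =
        Ideal.Quotient.mk negligibleReal (Matrix.vecMul S M j) :=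
      (RingHom.map_vecMul _ M S j).symm
    rw [h1]
    refine Ideal.Quotient.eq_zero_iff_mem.2 fun m => Asymptotics.IsBigO.of_bound 1 ?_
    filter_upwards [hsA m] with ε hε
    rw [one_mul, norm_eps_zpow]
    convert hε j using 2
    simp [Matrix.vecMul, dotProduct, Finset.sum_apply, S])
  have hsmall : ∀ᶠ ε : Eps in epsZero, ∀ i, |s ε i| < 1 := by
    rw [Filter.eventually_all]
    intro i
    obtain ⟨C, hC⟩ := (Ideal.Quotient.eq_zero_iff_mem.1 (congrFun hS i) 1).bound
    filter_upwards [hC, eventually_const_mul_eps_lt C one_pos] with ε h1 h2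
    refine lt_of_le_of_lt h1 ?_
    rwa [norm_eps_zpow, Nat.cast_one, zpow_one]
  obtain ⟨ε₀, hε₀, hlt⟩ := eventually_epsZero_iff.1 hsmall
  obtain ⟨k, hk⟩ := exists_nat_one_div_lt hε₀
  have hlt := (pi_norm_lt_iff (x := s (e k)) one_pos).2 (hlt (e k) ((he k).trans hk))
  have h : ∃ l, e l = e k := ⟨k, rfl⟩
  simp only [s, dif_pos h, hv, lt_irrefl] at hlt

section Flat

variable {n : ℕ} {Ω : TopologicalSpace.Opens (RSpace n)} {K : Set (RSpace n)}

theorem coe_det_apply {ι : Type*} [Fintype ι] [DecidableEq ι] (M : Matrix ι ι (moderateFun Ω))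
    (ε : Eps) (x : RSpace n) : M.det.1 ε x = (M.map fun u => u.1 ε x).det :=
  RingHom.map_det (((Pi.evalRingHom _ x).comp (Pi.evalRingHom _ ε)).comp
    (moderateFun Ω).subtype) M

/-- The determinant of a matrix of generalized functions whose point values annihilate no nonzero
vector is bounded below by powers of `ε` on compact sets. -/
theorem isBoundedBelow_det {d : ℕ} (M : Matrix (Fin d) (Fin d) (moderateFun Ω))
    (hM : ∀ (x : GPoint Ω) (v), Matrix.vecMul v
      ((M.map (Ideal.Quotient.mk (negligibleFun Ω))).map (pointValue x)) = 0 → v = 0) :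
    IsBoundedBelow Ω M.det.1 := by
  intro K hc hK
  rcases K.eq_empty_or_nonempty with rfl | hne
  · exact ⟨0, by simp⟩
  obtain ⟨x, hx⟩ := exists_compactNet_forall_le hc hK hne (fun ε y => -|M.det.1 ε y|)
    fun ε => ((M.det.2.1 ε).continuousOn.mono hK).abs.neg
  obtain ⟨N, hN⟩ := eventually_le_abs_det (M.map (netEval x)) (hM (Quotient.mk _ x))
  refine ⟨N, hN.mono fun ε hε y hy => hε.trans ?_⟩
  have := neg_le_neg_iff.1 ((hx ε).2 y hy)
  rwa [coe_det_apply M ε (x.1 ε)] at this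

end Flat

/-- The symmetric part of a bilinear form. -/
def symmPart (E : Type*) [NormedAddCommGroup E] [NormedSpace ℝ E] :
    (E →L[ℝ] E →L[ℝ] ℝ) →L[ℝ] (E →L[ℝ] E →L[ℝ] ℝ) :=
  (1 / 2 : ℝ) • (ContinuousLinearMap.id ℝ _ +
    (ContinuousLinearMap.flipₗᵢ ℝ E E ℝ).toContinuousLinearEquiv.toContinuousLinearMap)

theorem contMDiffAt_clm_comp {V W M H F : Type*} [NormedAddCommGroup V] [NormedSpace ℝ V]
    [NormedAddCommGroup W] [NormedSpace ℝ W] [TopologicalSpace H] [TopologicalSpace M]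
    [ChartedSpace H M] [NormedAddCommGroup F] [NormedSpace ℝ F] {I : ModelWithCorners ℝ F H}
    (L : V →L[ℝ] W) {f : M → V} {x : M} (hf : ContMDiffAt I 𝓘(ℝ, V) ∞ f x) :
    ContMDiffAt I 𝓘(ℝ, W) ∞ (fun y => L (f y)) x :=
  L.contMDiff.contMDiffAt.comp x hf

section Manifold

variable {n : ℕ} {X : Type*} [TopologicalSpace X] [ChartedSpace (RSpace n) X]

theorem mdifferentiable_of_mem_charts {φ : OpenPartialHomeomorph X (RSpace n)}
    (hφ : φ ∈ charts n X) : φ.MDifferentiable (𝓡 n) (𝓡 n) :=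
  ⟨(contMDiffOn_of_mem_maximalAtlas hφ).mdifferentiableOn (by simp),
    (contMDiffOn_symm_of_mem_maximalAtlas hφ).mdifferentiableOn (by simp)⟩

theorem tangentBundle_mk_eq {x z : X} (h : z = x) (w : RSpace n) :
    (⟨x, w⟩ : TangentBundle (𝓡 n) X) = ⟨z, w⟩ := by
  subst h
  rfl

variable [IsManifold (𝓡 n) ∞ X]

set_option synthInstance.maxHeartbeats 400000 in
/-- The symmetrization of a smooth `(0,2)`-tensor field. -/
def symmetrize (h : SmoothTensor02 n X) : SmoothTensor02 n X :=
  ⟨fun x => symmPart (RSpace n) (h x), fun x₀ => by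
    have hh := (contMDiffAt_hom_bundle _).1 (ContMDiffSection.contMDiff h x₀)
    refine (contMDiffAt_hom_bundle _).2 ⟨contMDiffAt_id, ?_⟩
    refine (contMDiffAt_clm_comp (symmPart (RSpace n)) hh.2).congr_of_eventuallyEq ?_
    have hmem : (trivializationAt (RSpace n) (TangentSpace (𝓡 n) : X → Type _) x₀).baseSet ∈ 𝓝 x₀ :=
      (trivializationAt (RSpace n) (TangentSpace (𝓡 n) : X → Type _) x₀).open_baseSet.mem_nhds
        (FiberBundle.mem_baseSet_trivializationAt' x₀)
    filter_upwards [hmem] with x hx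
    ext v w
    have key := fun φ : TangentSpace (𝓡 n) x →L[ℝ] TangentSpace (𝓡 n) x →L[ℝ] ℝ => fun v w =>
      inCoordinates_apply_eq₂ (𝕜 := ℝ) (F₁ := RSpace n) (F₂ := RSpace n)
        (F₃ := ℝ) (E₁ := (TangentSpace (𝓡 n) : X → Type _))
        (E₂ := (TangentSpace (𝓡 n) : X → Type _)) (E₃ := Bundle.Trivial X ℝ) (ϕ := φ) (v := v)
        (w := w) hx hx (mem_univ x)
    refine (key _ v w).trans (Eq.trans ?_ (congrArg (fun z => 1 / 2 * z)
      (congrArg₂ (· + ·) (key (h x) v w) (key (h x) w v))).symm)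
    simp only [Trivial.fiberBundle_trivializationAt', Trivial.linearMapAt_trivialization,
      LinearMap.id_coe, id_eq]
    rfl⟩

theorem contDiffOn_vfComp {φ : OpenPartialHomeomorph X (RSpace n)} (hφ : φ ∈ charts n X)
    (ξ : SmoothVF n X) (i : Fin n) : ContDiffOn ℝ ∞ (vfComp φ ξ i) φ.target := by
  have := IsManifold.of_le (I := 𝓡 n) (M := X) (m := 1) (n := ∞) (by simp)
  have h1 : ContMDiffOn (𝓡 n) (𝓡 n).tangent ∞
      (fun y => (⟨φ.symm y, ξ (φ.symm y)⟩ : TangentBundle (𝓡 n) X)) φ.target :=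
    ξ.contMDiff.comp_contMDiffOn (contMDiffOn_symm_of_mem_maximalAtlas hφ)
  have h2 := (contMDiffOn_of_mem_maximalAtlas hφ).contMDiffOn_tangentMapWithin (m := ∞) (by simp)
    φ.open_source.uniqueMDiffOn
  have h3 := h2.comp h1 (fun y hy => φ.map_target hy)
  have h4 :=
    ((contMDiff_snd_tangentBundle_modelSpace (RSpace n) (𝓡 n)).comp_contMDiffOn h3).contDiffOn
  have h5 : ContDiffOn ℝ ∞ (fun y => (mfderiv (𝓡 n) (𝓡 n) φ (φ.symm y) (ξ (φ.symm y)) : RSpace n))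
      φ.target := h4.congr fun y hy => by
    have : mfderivWithin (𝓡 n) (𝓡 n) φ φ.source (φ.symm y) = mfderiv (𝓡 n) (𝓡 n) φ (φ.symm y) :=
      mfderivWithin_of_isOpen φ.open_source (φ.map_target hy)
    rw [← this]
    rfl
  exact contDiffOn_euclidean.1 h5 i

/-- A constant net of vector fields is moderate. -/
def constVF (ξ : SmoothVF n X) : moderateVF n X :=
  ⟨fun _ => ξ, fun _ hφ i => ⟨fun _ => contDiffOn_vfComp hφ ξ i,
    isModerate_of_contDiffOn (contDiffOn_vfComp hφ ξ i)⟩⟩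

theorem contMDiffOn_coordVec {φ : OpenPartialHomeomorph X (RSpace n)} (hφ : φ ∈ charts n X)
    (i : Fin n) : ContMDiffOn (𝓡 n) (𝓡 n).tangent ∞
      (fun x => (⟨x, (coordVec φ i (φ x) : RSpace n)⟩ : TangentBundle (𝓡 n) X)) φ.source := by
  have := IsManifold.of_le (I := 𝓡 n) (M := X) (m := 1) (n := ∞) (by simp)
  have h1 : ContMDiff (𝓡 n) (𝓡 n).tangent ∞
      (fun y : RSpace n =>
        (⟨y, EuclideanSpace.single i (1 : ℝ)⟩ : TangentBundle (𝓡 n) (RSpace n))) :=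
    contMDiff_vectorSpace_iff_contDiff.2 contDiff_const
  have h2 := (contMDiffOn_symm_of_mem_maximalAtlas hφ).contMDiffOn_tangentMapWithin (m := ∞)
    (by simp) φ.open_target.uniqueMDiffOn
  have h3 := h2.comp (h1.comp_contMDiffOn (contMDiffOn_of_mem_maximalAtlas hφ))
    (fun y hy => φ.map_source hy)
  refine h3.congr fun x hx => ?_
  have h4 : mfderivWithin (𝓡 n) (𝓡 n) φ.symm φ.target (φ x) = mfderiv (𝓡 n) (𝓡 n) φ.symm (φ x) :=
    mfderivWithin_of_isOpen φ.open_target (φ.map_source hx)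
  simp only [Function.comp_def, tangentMapWithin, h4]
  exact tangentBundle_mk_eq (φ.left_inv hx) _

/-- A vector field which coincides with `∂_i` over a compact subset of a chart. -/
theorem exists_vfComp_eq_single [T2Space X] {φ : OpenPartialHomeomorph X (RSpace n)}
    (hφ : φ ∈ charts n X) {K : Set (RSpace n)} (hc : IsCompact K) (hK : K ⊆ φ.target)
    (i : Fin n) :
    ∃ ξ : SmoothVF n X, ∀ y ∈ K, ∀ j, vfComp φ ξ j y = if j = i then 1 else 0 := by
  classical
  obtain ⟨L, hL, hKL, hLφ⟩ := exists_compact_between hc φ.open_target hK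
  obtain ⟨χ, hχ1, hχ0, -⟩ := exists_contMDiffMap_one_nhds_of_subset_interior (n := ⊤) (𝓡 n)
    hc.isClosed hKL
  have hclosed : IsClosed (φ.symm '' L) :=
    (hL.image_of_continuousOn (φ.symm.continuousOn.mono hLφ)).isClosed
  let s : ∀ x : X, TangentSpace (𝓡 n) x := fun x =>
    if x ∈ φ.source then χ (φ x) • (coordVec φ i (φ x) : RSpace n) else (0 : RSpace n)
  have hs : ContMDiff (𝓡 n) (𝓡 n).tangent ∞ (fun x => (⟨x, s x⟩ : TangentBundle (𝓡 n) X)) := by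
    intro x
    by_cases hx : x ∈ φ.source
    · have h1 : ContMDiffAt (𝓡 n) 𝓘(ℝ, ℝ) ∞ (fun x => χ (φ x)) x :=
        χ.contMDiff.contMDiffAt.comp x (contMDiffAt_of_mem_maximalAtlas hφ hx)
      have h2 := (contMDiffOn_coordVec hφ i).contMDiffAt (φ.open_source.mem_nhds hx)
      refine (h1.smul_section h2).congr_of_eventuallyEq ?_
      filter_upwards [φ.open_source.mem_nhds hx] with z hz
      exact congrArg (TotalSpace.mk z) (if_pos hz)
    · refine (Bundle.contMDiff_zeroSection ℝ (TangentSpace (𝓡 n) : X → Type _)).contMDiffAt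
        |>.congr_of_eventuallyEq ?_
      have hx' : x ∉ φ.symm '' L := by
        rintro ⟨y, hy, rfl⟩
        exact hx (φ.map_target (hLφ hy))
      filter_upwards [hclosed.isOpen_compl.mem_nhds hx'] with z hz
      have : s z = 0 := by
        by_cases hz' : z ∈ φ.source
        · have : φ z ∉ L := fun h => hz ⟨φ z, h, φ.left_inv hz'⟩
          exact (if_pos hz').trans (by rw [hχ0 _ this, zero_smul]; rfl)
        · exact if_neg hz'
      rw [this]
      rfl
  refine ⟨⟨s, hs⟩, fun y hy j => ?_⟩
  have hyt := hK hy
  have hχ : χ y = 1 := hχ1.self_of_nhdsSet y hy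
  have h1 : (s (φ.symm y) : RSpace n) = coordVec φ i y := by
    have hz : ∀ z : RSpace n, z = y →
        χ z • (coordVec φ i z : RSpace n) = (coordVec φ i y : RSpace n) := by
      rintro _ rfl
      rw [hχ, one_smul]
    exact (if_pos (φ.map_target hyt)).trans (hz _ (φ.right_inv hyt))
  have h2 := DFunLike.congr_fun ((mdifferentiable_of_mem_charts hφ).comp_symm_deriv hyt)
    (EuclideanSpace.single i (1 : ℝ) : RSpace n)
  have h3 : (mfderiv (𝓡 n) (𝓡 n) φ (φ.symm y) (s (φ.symm y)) : RSpace n) =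
      EuclideanSpace.single i (1 : ℝ) :=
    (congrArg (mfderiv (𝓡 n) (𝓡 n) φ (φ.symm y) : RSpace n → RSpace n) h1).trans h2
  have h4 := congrArg (fun w : RSpace n => w j) h3
  refine h4.trans ?_
  simp

end Manifold
section Manifold

variable {n : ℕ} {X : Type*} [TopologicalSpace X] [ChartedSpace (RSpace n) X]

theorem exists_eq_sum_coordVec {φ : OpenPartialHomeomorph X (RSpace n)} (hφ : φ ∈ charts n X)
    {y : RSpace n} (hy : y ∈ φ.target) (v : TangentSpace (𝓡 n) (φ.symm y)) :
    ∃ a : Fin n → ℝ, v = ∑ i, a i • coordVec φ i y := by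
  have hd := mdifferentiable_of_mem_charts hφ
  set w : RSpace n := mfderiv (𝓡 n) (𝓡 n) φ (φ.symm y) v with hw
  have h1 : (mfderiv (𝓡 n) (𝓡 n) φ.symm y : RSpace n →L[ℝ] RSpace n) w = v := by
    have h := DFunLike.congr_fun (hd.symm_comp_deriv (φ.map_target hy)) v
    have hz : ∀ z : RSpace n, z = y →
        (mfderiv (𝓡 n) (𝓡 n) φ.symm z : RSpace n →L[ℝ] RSpace n) w =
          (mfderiv (𝓡 n) (𝓡 n) φ.symm y : RSpace n →L[ℝ] RSpace n) w := by
      rintro _ rfl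
      rfl
    exact (hz _ (φ.right_inv hy)).symm.trans h
  have h2 : w = ∑ i, w i • (EuclideanSpace.single i (1 : ℝ) : RSpace n) := by
    ext j
    simp [Finset.sum_apply, Pi.single_apply]
  have h3 : ∀ L : RSpace n →L[ℝ] RSpace n,
      L w = ∑ i, w i • L (EuclideanSpace.single i (1 : ℝ)) := fun L => by
    conv_lhs => rw [h2, map_sum]
    exact Finset.sum_congr rfl fun i _ => map_smul _ _ _
  exact ⟨w, h1.symm.trans (h3 _)⟩

variable [IsManifold (𝓡 n) ∞ X]

/-- The matrix of components, in a chart, of a moderate net of `(0,2)`-tensor fields. -/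
def netMatrix (gε : moderateTensor02 n X) (φ : OpenPartialHomeomorph X (RSpace n))
    (hφ : φ ∈ charts n X) : Matrix (Fin n) (Fin n) (moderateFun (chartImage φ)) :=
  Matrix.of fun i j => moderateTensor02.comp φ hφ i j gε

theorem det_matrix_mk (gε : moderateTensor02 n X) (φ : OpenPartialHomeomorph X (RSpace n))
    (hφ : φ ∈ charts n X) : (GTensor02.matrix (QuotientAddGroup.mk gε) φ hφ).det =
      Ideal.Quotient.mk (negligibleFun (chartImage φ)) (netMatrix gε φ hφ).det :=
  (RingHom.map_det (Ideal.Quotient.mk (negligibleFun (chartImage φ))) (netMatrix gε φ hφ)).symm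

/-- All component matrices of `g` are symmetric. -/
def GTensor02.MatrixSymm (g : GTensor02 n X) : Prop :=
  ∀ (φ : OpenPartialHomeomorph X (RSpace n)) (hφ : φ ∈ charts n X), (g.matrix φ hφ).IsSymm

theorem GTensor02.MatrixSymm.isSymmetric {g : GTensor02 n X} (h : g.MatrixSymm) :
    g.IsSymmetric := by
  intro ξ η
  induction g using QuotientAddGroup.induction_on with | _ g => ?_
  induction ξ using QuotientAddGroup.induction_on with | _ ξ => ?_
  induction η using QuotientAddGroup.induction_on with | _ η => ?_
  change Ideal.Quotient.mk (negligibleFunM n X) (netPairing g ξ η) =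
    Ideal.Quotient.mk (negligibleFunM n X) (netPairing g η ξ)
  rw [Ideal.Quotient.eq, negligibleFunM, Submodule.mem_iInf]
  rintro ⟨φ, hφ⟩
  rw [Ideal.mem_comap, map_sub, ← Ideal.Quotient.eq, mk_local_netPairing, mk_local_netPairing,
    Finset.sum_comm]
  refine Finset.sum_congr rfl fun j _ => Finset.sum_congr rfl fun i _ => ?_
  have hij : Ideal.Quotient.mk (negligibleFun (chartImage φ)) (moderateTensor02.comp φ hφ i j g) =
      Ideal.Quotient.mk (negligibleFun (chartImage φ)) (moderateTensor02.comp φ hφ j i g) :=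
    (h φ hφ).apply j i
  rw [hij]
  ring

theorem smoothPairing_of_vfComp_eq_single {φ : OpenPartialHomeomorph X (RSpace n)}
    (hφ : φ ∈ charts n X) (h : SmoothTensor02 n X) {ξ η : SmoothVF n X} {y : RSpace n}
    (hy : y ∈ φ.target) {i j : Fin n} (hξ : ∀ k, vfComp φ ξ k y = if k = i then 1 else 0)
    (hη : ∀ k, vfComp φ η k y = if k = j then 1 else 0) :
    smoothPairing h ξ η (φ.symm y) = tensorComp φ h i j y := by
  refine (tensor_eq_sum hφ h ξ η hy).trans ?_
  simp [hξ, hη]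

theorem GTensor02.IsSymmetric.matrixSymm [T2Space X] {g : GTensor02 n X} (h : g.IsSymmetric) :
    g.MatrixSymm := by
  intro φ hφ
  induction g using QuotientAddGroup.induction_on with | _ g => ?_
  refine Matrix.IsSymm.ext fun i j => eq_of_forall_pointValue_eq fun x => ?_
  induction x using Quotient.inductionOn with | _ x => ?_
  obtain ⟨K, hc, hK, hxK⟩ := x.2.2
  obtain ⟨ξ, hξ⟩ := exists_vfComp_eq_single hφ hc hK i
  obtain ⟨η, hη⟩ := exists_vfComp_eq_single hφ hc hK j
  have h1 : Ideal.Quotient.mk (negligibleFunM n X) (netPairing g (constVF η) (constVF ξ)) =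
      Ideal.Quotient.mk (negligibleFunM n X) (netPairing g (constVF ξ) (constVF η)) :=
    h (QuotientAddGroup.mk (constVF η)) (QuotientAddGroup.mk (constVF ξ))
  rw [Ideal.Quotient.eq, negligibleFunM, Submodule.mem_iInf] at h1
  refine Ideal.Quotient.eq.2 fun m => ((h1 ⟨φ, hφ⟩ K hc hK 0 m).comp_zero x.1 hxK).congr' ?_
    EventuallyEq.rfl
  filter_upwards [hxK] with ε hε
  exact congrArg₂ (· - ·)
    (smoothPairing_of_vfComp_eq_single hφ (g.1 ε) (hK hε) (hη _ hε) (hξ _ hε))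
    (smoothPairing_of_vfComp_eq_single hφ (g.1 ε) (hK hε) (hξ _ hε) (hη _ hε))

theorem GTensor02.forall_formAt_iff {g : GTensor02 n X} :
    (∀ (φ : OpenPartialHomeomorph X (RSpace n)) (hφ : φ ∈ charts n X)
      (x : GPoint (chartImage φ)), (g.formAt φ hφ x).IsSymm ∧ (g.formAt φ hφ x).Nondegenerate) ↔
      g.MatrixSymm ∧ g.DetInvertible := by
  simp only [formAt, Matrix.isSymm_toBilin'_iff_isSymm,
    Matrix.nondegenerate_toBilin'_iff]
  refine ⟨fun h => ⟨fun φ hφ => Matrix.IsSymm.ext fun i j =>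
    eq_of_forall_pointValue_eq fun x => (h φ hφ x).1.apply i j, fun φ hφ => ?_⟩,
    fun h φ hφ x => ⟨(h.1 φ hφ).map _, Matrix.Nondegenerate.of_det_mem_nonZeroDivisors ?_⟩⟩
  · induction g using QuotientAddGroup.induction_on with | _ g => ?_
    rw [det_matrix_mk]
    exact isUnit_mk_of_isBoundedBelow _ (isBoundedBelow_det _ fun x v =>
      (h φ hφ x).2.separatingLeft.eq_zero_of_vecMul_eq_zero)
  · refine IsUnit.mem_nonZeroDivisors ?_
    have := (h.2 φ hφ).map (pointValue x)
    rwa [RingHom.map_det] at this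

/-- A tensor field is non-degenerate where its component matrix has nonzero determinant. -/
theorem eq_zero_of_det_ne_zero {φ : OpenPartialHomeomorph X (RSpace n)} (hφ : φ ∈ charts n X)
    (h : SmoothTensor02 n X) {y : RSpace n} (hy : y ∈ φ.target)
    (hdet : (Matrix.of fun i j => tensorComp φ h i j y).det ≠ 0)
    {v : TangentSpace (𝓡 n) (φ.symm y)} (hv : ∀ w, h (φ.symm y) v w = 0) : v = 0 := by
  obtain ⟨a, rfl⟩ := exists_eq_sum_coordVec hφ hy v
  have : a = 0 := Matrix.eq_zero_of_vecMul_eq_zero hdet (funext fun j => by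
    have := hv (coordVec φ j y)
    simp only [map_sum, map_smul, sum_apply, smul_apply, smul_eq_mul] at this
    exact this)
  simp [this]

/-- The symmetrization of a moderate net of `(0,2)`-tensor fields. -/
def netSymmetrize (gε : moderateTensor02 n X) : moderateTensor02 n X :=
  ⟨fun ε => symmetrize (gε.1 ε), fun φ hφ i j =>
    mul_mem (s := moderateFun (chartImage φ))
      (⟨fun _ => contDiffOn_const, isModerate_const (1 / 2)⟩ :
        (fun _ _ => 1 / 2) ∈ moderateFun (chartImage φ))
      (add_mem (gε.2 φ hφ i j) (gε.2 φ hφ j i))⟩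

theorem isRepresentative_netSymmetrize {gε : moderateTensor02 n X}
    (h : GTensor02.MatrixSymm (QuotientAddGroup.mk gε)) :
    IsRepresentative (netSymmetrize gε) (QuotientAddGroup.mk gε) := by
  refine QuotientAddGroup.eq.2 ?_
  simp only [negligibleTensor02, AddSubgroup.mem_iInf]
  rintro ⟨φ, hφ⟩ i j
  have hij : Ideal.Quotient.mk (negligibleFun (chartImage φ)) (moderateTensor02.comp φ hφ j i gε) =
      Ideal.Quotient.mk (negligibleFun (chartImage φ)) (moderateTensor02.comp φ hφ i j gε) :=
    (h φ hφ).apply i j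
  have hmul := Ideal.mul_mem_left _ (⟨fun _ _ => -(1 / 2), fun _ => contDiffOn_const,
    isModerate_const (-(1 / 2))⟩ : moderateFun (chartImage φ)) (Ideal.Quotient.eq.1 hij)
  refine IsNegligible.congr hmul fun ε y _ => ?_
  change -(1 / 2) * (tensorComp φ (gε.1 ε) j i y - tensorComp φ (gε.1 ε) i j y) =
    -(1 / 2 * (tensorComp φ (gε.1 ε) i j y + tensorComp φ (gε.1 ε) j i y)) +
      tensorComp φ (gε.1 ε) i j y
  ring

/-- A representative of a tensor field with invertible determinant is non-degenerate, locally
uniformly in `ε`. -/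
theorem exists_nhds_eventually_nondegenerate {gε : moderateTensor02 n X}
    (h : GTensor02.DetInvertible (QuotientAddGroup.mk gε)) (p : X) :
    ∃ U ∈ 𝓝 p, ∀ᶠ ε : Eps in epsZero, ∀ q ∈ U, ∀ v : TangentSpace (𝓡 n) q,
      (∀ w : TangentSpace (𝓡 n) q, gε.1 ε q v w = 0) → v = 0 := by
  set φ := chartAt (RSpace n) p
  have hφ : φ ∈ charts n X := IsManifold.chart_mem_maximalAtlas p
  have hp : p ∈ φ.source := mem_chart_source _ p
  obtain ⟨r, hr, hball⟩ := Metric.nhds_basis_closedBall.mem_iff.1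
    (φ.open_target.mem_nhds (φ.map_source hp))
  refine ⟨φ.source ∩ φ ⁻¹' Metric.closedBall (φ p) r,
    inter_mem (φ.open_source.mem_nhds hp)
      ((φ.continuousAt hp).preimage_mem_nhds (Metric.closedBall_mem_nhds _ hr)), ?_⟩
  have hunit := h φ hφ
  rw [det_matrix_mk] at hunit
  filter_upwards [eventually_ne_zero_of_isUnit_mk hunit (isCompact_closedBall _ _) hball]
    with ε hε q hq
  have hq' := hε (φ q) hq.2
  rw [coe_det_apply] at hq'
  have key := fun v => eq_zero_of_det_ne_zero hφ (gε.1 ε) (φ.map_source hq.1) hq' (v := v)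
  rwa [φ.left_inv hq.1] at key

theorem GTensor02.MatrixSymm.exists_representative [T2Space X] {g : GTensor02 n X}
    (hs : g.MatrixSymm) (hd : g.DetInvertible) {V : Set X} (hV : IsCompact (closure V)) :
    ∃ gε : moderateTensor02 n X, IsRepresentative gε g ∧
      ∃ ε₀ : ℝ, 0 < ε₀ ∧ ∀ ε : Eps, (ε : ℝ) < ε₀ → IsPseudoRiemannianOn (gε.1 ε) V := by
  induction g using QuotientAddGroup.induction_on with | _ g => ?_
  have hrep := isRepresentative_netSymmetrize hs
  refine ⟨netSymmetrize g, hrep, ?_⟩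
  rw [← hrep] at hd
  rw [← eventually_epsZero_iff]
  have key : ∀ᶠ ε : Eps in epsZero, ∀ q ∈ closure V, ∀ v : TangentSpace (𝓡 n) q,
      (∀ w : TangentSpace (𝓡 n) q, (netSymmetrize g).1 ε q v w = 0) → v = 0 := by
    refine hV.induction_on (p := fun S => ∀ᶠ ε : Eps in epsZero, ∀ q ∈ S,
      ∀ v : TangentSpace (𝓡 n) q,
      (∀ w : TangentSpace (𝓡 n) q, (netSymmetrize g).1 ε q v w = 0) → v = 0)
      (by simp) (fun S T hST hT => hT.mono fun ε hε q hq => hε q (hST hq))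
      (fun S T hS hT => ?_) (fun p _ => ?_)
    · filter_upwards [hS, hT] with ε h1 h2 q hq
      exact hq.elim (h1 q) (h2 q)
    · obtain ⟨U, hU, h⟩ := exists_nhds_eventually_nondegenerate hd p
      exact ⟨U, mem_nhdsWithin_of_mem_nhds hU, h⟩
  filter_upwards [key] with ε hε p hp
  refine ⟨fun v w => ?_, hε p (subset_closure hp)⟩
  exact congrArg (fun z : ℝ => 1 / 2 * z) (add_comm (g.1 ε p v w) (g.1 ε p w v))

theorem GTensor02.matrixSymm_of_forall_exists_representative [T2Space X] {g : GTensor02 n X}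
    (h : ∀ V : Set X, IsOpen V → IsCompact (closure V) →
      ∃ gε : moderateTensor02 n X, IsRepresentative gε g ∧
        ∃ ε₀ : ℝ, 0 < ε₀ ∧ ∀ ε : Eps, (ε : ℝ) < ε₀ → IsPseudoRiemannianOn (gε.1 ε) V) :
    g.MatrixSymm := by
  intro φ hφ
  refine Matrix.IsSymm.ext fun i j => eq_of_forall_pointValue_eq fun x => ?_
  induction x using Quotient.inductionOn with | _ x => ?_
  obtain ⟨K, hc, hK, hxK⟩ := x.2.2
  obtain ⟨U, hU, hKU, hUφ, hUc⟩ :=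
    exists_open_between_and_isCompact_closure hc φ.open_target hK
  have himage : IsCompact (φ.symm '' closure U) :=
    hUc.image_of_continuousOn (φ.symm.continuousOn.mono hUφ)
  obtain ⟨gε, rfl, hgε⟩ := h (φ.symm '' U)
    (φ.symm.isOpen_image_of_subset_source hU (subset_closure.trans hUφ))
    (himage.of_isClosed_subset isClosed_closure
      (closure_minimal (image_mono subset_closure) himage.isClosed))
  rw [← eventually_epsZero_iff] at hgε
  refine Ideal.Quotient.eq.2 fun m =>
    (Asymptotics.isBigO_zero _ _).congr' (f₁ := fun _ => 0) ?_ EventuallyEq.rfl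
  filter_upwards [hxK, hgε] with ε hε hg
  exact (sub_eq_zero.2 ((hg _ (mem_image_of_mem _ (hKU hε))).1 _ _)).symm

end Manifold

end Colombeau

end

theorem theorem1 {n : ℕ} {X : Type*} [TopologicalSpace X] [T2Space X] [ParacompactSpace X]
    [ChartedSpace (Colombeau.RSpace n) X] [IsManifold (𝓡 n) ∞ X]
    (g : Colombeau.GTensor02 n X) :
    List.TFAE [
      ∀ (φ : OpenPartialHomeomorph X (Colombeau.RSpace n)) (hφ : φ ∈ Colombeau.charts n X)
        (x : Colombeau.GPoint (Colombeau.chartImage φ)),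
        (g.formAt φ hφ x).IsSymm ∧ (g.formAt φ hφ x).Nondegenerate,
      g.IsSymmetric ∧ g.DetInvertible,
      g.DetInvertible ∧
        ∀ V : Set X, IsOpen V → IsCompact (closure V) →
          ∃ gε : Colombeau.moderateTensor02 n X, Colombeau.IsRepresentative gε g ∧
            ∃ ε₀ : ℝ, 0 < ε₀ ∧ ∀ ε : Colombeau.Eps, (ε : ℝ) < ε₀ →
              Colombeau.IsPseudoRiemannianOn (gε.1 ε) V] := by
  rw [Colombeau.GTensor02.forall_formAt_iff]
  tfae_have 1 → 2 := fun h => ⟨h.1.isSymmetric, h.2⟩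
  tfae_have 2 → 3 := fun h => ⟨h.2, fun _ _ hV => h.1.matrixSymm.exists_representative h.2 hV⟩
  tfae_have 3 → 1 := fun h =>
    ⟨Colombeau.GTensor02.matrixSymm_of_forall_exists_representative h.2, h.1⟩
  tfae_finish
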